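/- \textbf{Setting and notation.} For $x=(x_t)_{t\in\mathbb Z}\in\mathbb C^{\mathbb Z}$ put $\|x\|_{n,2}=\big(\sum_{t=0}^n|x_t|^2\big)^{1/2}$, $[\Delta x]_t=x_{t-1}$, $[u*v]_t=\sum_{\tau\in\mathbb Z}u_\tau v_{t-\tau}$, and $\|x\|^*_{n,1}=\sum_{k=0}^n|[F_nx]_k|$, where $[F_nx]_k=(n+1)^{-1/2}\sum_{t=0}^n x_t e^{2\pi i kt/(n+1)}$ is the unitary discrete Fourier transform. Let $\mathbb C(\mathbb Z_0^m)$ be the set of sequences that vanish outside $[0,m]$ (filters). Let $\sigma\ge 0$ and let $y_\tau=x_\tau+\sigma\zeta_\tau$, $-m\le\tau\le n$, where the $\zeta_\tau$ are i.i.d. standard complex Gaussian, i.e. $\zeta_\tau=\xi^1_\tau+i\xi^2_\tau$ with $\xi^1_\tau,\xi^2_\tau$ independent $\mathcal N(0,1)$. For $\overline\varrho\ge 1$, the constrained recovery is $\widehat x_{\rm con}=\widehat\varphi*y$ on $\{0,\dots,n\}$, where $\widehat\varphi$ is any optimal solution of $$\min_{\varphi\in\mathbb C(\mathbb Z_0^m)}\big\{\|y-\varphi*y\|_{n,2}:\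 \|\varphi\|^*_{m,1}\le\overline\varrho/\sqrt{m+1}\big\}.$$ \textbf{Assumption A} (with parameters $m,n,s,\varkappa$). $1\le s\le n+1$, and $x=x^{\mathcal S}+\varepsilon$ with $x^{\mathcal S}\in\mathcal S$, where $\mathcal S$ is some linear subspace of $\mathbb C^{\mathbb Z}$ of dimension $s$ with $\Delta\mathcal S=\mathcal S$, and $\|\Delta^\tau\varepsilon\|_{n,2}\le\sigma\varkappa$ for all $0\le\tau\le m$. \textbf{Theorem.} Suppose that Assumption A holds and that $\varphi^o\in\mathbb C(\mathbb Z_0^m)$ satisfies $\|\varphi^o\|^*_{m,1}\le\overline\varrho/\sqrt{m+1}$. (1) Let $m=n\ge1$. For every $\alpha_0<1$ there is a constant $C$ that depends only on $\alpha_0$ (in particular, an absolute constant for $\alpha\le 1/2$) such that for all $0<\alpha\le\alpha_0$, with probability at least $1-\alpha$, $$\|x-\widehat x_{\rm con}\|_{n,2}\le\|x-\varphi^o*y\|_{n,2}+C\sigma\sqrt{s+\overline\varrho\big(\varkappa\sqrt{\ln(1/\alpha)}+\ln(n/\alpha)\big)}.$$ (2) Let $m,n\ge 0$ be integers and $0<\alpha\le1$.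 There is a measurable set $\Xi\subset\mathbb C^{m+n+1}$ with $\mathrm{Prob}\{(\zeta_{-m},\dots,\zeta_n)\in\Xi\}\ge1-\alpha$ such that, whenever $(\zeta_{-m},\dots,\zeta_n)\in\Xi$, $$\|x-\widehat\varphi*y\|_{n,2}\le\|x-\varphi^o*y\|_{n,2}+2\sigma\Big[\sqrt{\overline\varrho V_\alpha^2+(\overline\varrho+1)c_\alpha\varkappa}+\sqrt{2s}+c_\alpha\Big],$$ where $c_\alpha=\sqrt{2\ln(16/\alpha)}$ and $V_\alpha^2=2\Big(1+4\sqrt{\tfrac{n+1}{m+1}}\Big)^2\ln\big(55(m+n+1)/\alpha\big)$. -/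

import Mathlib

open MeasureTheory ProbabilityTheory

namespace FilterRecovery

noncomputable section

/-- Two-sided complex sequences. -/
abbrev Signal : Type := ℤ → ℂ

/-- The right shift `[Δ x]_t = x_{t-1}`. -/
def shift : Signal →ₗ[ℂ] Signal :=
  LinearMap.funLeft ℂ ℂ (fun t : ℤ => t - 1)

/-- The filters of order `m`: sequences that vanish outside `[0, m]`. -/
def IsFilter (m : ℕ) (φ : Signal) : Prop :=
  ∀ t : ℤ, t ∉ Set.Icc (0 : ℤ) (m : ℤ) → φ t = 0

/-- The convolution `[u * v]_t = ∑_τ u_τ v_{t-τ}`. It is only used for finitely supported `u`. -/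
def conv (u v : Signal) : Signal :=
  fun t => ∑ᶠ τ : ℤ, u τ * v (t - τ)

/-- The Euclidean norm of `(x_0, …, x_n)`. -/
def norm2 (n : ℕ) (x : Signal) : ℝ :=
  √(∑ t ∈ Finset.range (n + 1), ‖x (t : ℤ)‖ ^ 2)

/-- The `k`-th coordinate of the unitary discrete Fourier transform of `(z_0, …, z_n)`. -/
def dft (n : ℕ) (z : Signal) (k : ℕ) : ℂ :=
  ((√((n : ℝ) + 1))⁻¹ : ℝ) * ∑ t ∈ Finset.range (n + 1),
    z (t : ℤ) * Complex.exp (2 * Real.pi * Complex.I * (k : ℂ) * (t : ℂ) / ((n : ℂ) + 1))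

/-- The `ℓ¹` norm of the discrete Fourier transform of `(z_0, …, z_n)`. -/
def dftNorm1 (n : ℕ) (z : Signal) : ℝ :=
  ∑ k ∈ Finset.range (n + 1), ‖dft n z k‖

/-- The feasible filters: order `m`, and the `ℓ¹` norm of the DFT at most `ρ / √(m+1)`. -/
def IsFeasible (m : ℕ) (ρ : ℝ) (φ : Signal) : Prop :=
  IsFilter m φ ∧ dftNorm1 m φ ≤ ρ / √((m : ℝ) + 1)

/-- `φ` is an optimal solution of the constrained least-squares problem: it minimizes
`‖y - φ * y‖_{n,2}` over the feasible filters. -/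
def IsConstrainedRecoveryFilter (m n : ℕ) (ρ : ℝ) (y φ : Signal) : Prop :=
  IsFeasible m ρ φ ∧
    ∀ ψ : Signal, IsFeasible m ρ ψ → norm2 n (y - conv φ y) ≤ norm2 n (y - conv ψ y)

/-- `x` is the sum of an element of some shift-invariant subspace of dimension `s`,
`1 ≤ s ≤ n + 1`, and of a sequence `ε` with `‖Δ^τ ε‖_{n,2} ≤ r` for `0 ≤ τ ≤ m`. -/
def NearShiftInvariant (m n s : ℕ) (r : ℝ) (x : Signal) : Prop :=
  1 ≤ s ∧ s ≤ n + 1 ∧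
    ∃ S : Submodule ℂ Signal, S.map shift = S ∧ Module.finrank ℂ S = s ∧
      ∃ xS ∈ S, ∃ ε : Signal, x = xS + ε ∧
        ∀ τ : ℕ, τ ≤ m → norm2 n ((shift ^ τ) ε) ≤ r

/-- The law of `ξ₁ + i ξ₂` with `ξ₁`, `ξ₂` independent standard real Gaussian variables. -/
def stdComplexGaussian : Measure ℂ :=
  ((gaussianReal 0 1).prod (gaussianReal 0 1)).map (fun p : ℝ × ℝ => (⟨p.1, p.2⟩ : ℂ))

/-- The times `-m, …, n` at which the signal is observed. -/
abbrev Window (m n : ℕ) : Type := Set.Icc (-(m : ℤ)) (n : ℤ)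

/-- `ζ_τ`, `-m ≤ τ ≤ n`, are i.i.d. standard complex Gaussian random variables. -/
structure IsGaussianNoise {Ω : Type*} [MeasurableSpace Ω] (P : Measure Ω) (m n : ℕ)
    (ζ : ℤ → Ω → ℂ) : Prop where
  measurable : ∀ τ : Window m n, Measurable (ζ τ)
  law : ∀ τ : Window m n, P.map (ζ τ) = stdComplexGaussian
  indep : iIndepFun (fun τ : Window m n => ζ τ) P

/-- The observations `y_τ = x_τ + σ ζ_τ`. Only their values in the window matter. -/
def obs {Ω : Type*} (x : Signal) (σ : ℝ) (ζ : ℤ → Ω → ℂ) (ω : Ω) : Signal :=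
  fun τ => x τ + (σ : ℂ) * ζ τ ω

end

end FilterRecovery

namespace FilterRecovery

noncomputable section

open scoped ENNReal

/-! ### Complex Gaussian vectors: invariance and exponential moments. -/

section Gaussian

/-! Let a and b be the residuals x - φ * y on {0, …, n} for the optimal filter and for φo, and let ξ
be the noise there. Optimality, after expanding the squares, gives ‖a‖² ≤ ‖b‖² + 2σ Re⟨ξ, b - a⟩.
Let U be the restriction of the shift-invariant space to {0, …, n}; its dimension is at most s. The
projection P of ξ onto U contributes at most ‖P‖(‖a‖ + ‖b‖), and ‖P‖ is about √(2s). The orthogonal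
part Q does not see φ * u, where u is the component of x in the invariant space, because every shift
of u stays in that space. Only ⟨Q, φ * ε⟩ and σ⟨Q, φ * ζ⟩ remain, to be bounded uniformly over
feasible φ. A quadratic inequality in ‖a‖ then finishes the deterministic argument
(`norm2_recovery_le`).

For ⟨Q, φ * ε⟩, Parseval bounds ‖φ‖₂ by ρ/√(m+1), so Cauchy–Schwarz reduces the task to the mean
over τ of |⟨Q, Δ^τ ε⟩|². Its tail is controlled as a mean, not as a maximum, which avoids a factor
ln m next to κ (`gaussianVec_sum_norm_inner_sq_gt_le`).

For ⟨Q, φ * ζ⟩, expanding φ in its Fourier transform and using the ℓ¹ constraint leaves a maximum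
over m + 1 frequencies. At each frequency, modulation turns the form into the moving-average form
`averageForm`, with a 0/1 Toeplitz kernel. Such a kernel embeds in a circulant of order N, whose
eigenvalues are Dirichlet kernels: their maximum is at most the band length l and their absolute sum
is at most l + N(1 + ln N). These quantities bound an exponential moment of the form through
`lintegral_exp_sum_norm_sq_le`, and Chebyshev gives the tail (`gaussianVec_averageForm_gt_le`).

The second part is the explicit estimate on the intersection of these events; the first part is its
specialization m = n with the constants absorbed (`explicit_error_le`). -/

theorem measurable_complex_mk : Measurable (fun p : ℝ × ℝ => (⟨p.1, p.2⟩ : ℂ)) :=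
  Complex.measurableEquivRealProd.symm.measurable

instance : IsProbabilityMeasure stdComplexGaussian := by
  unfold stdComplexGaussian
  exact Measure.isProbabilityMeasure_map measurable_complex_mk.aemeasurable

theorem charFun_stdComplexGaussian (t : ℂ) :
    charFun stdComplexGaussian t = Complex.exp (-(‖t‖ : ℂ) ^ 2 / 2) := by
  have hm := measurable_complex_mk
  rw [charFun_apply, stdComplexGaussian, integral_map hm.aemeasurable
    (Continuous.aestronglyMeasurable (by fun_prop))]
  have h1 : ∀ p : ℝ × ℝ,
      Complex.exp ((inner ℝ (⟨p.1, p.2⟩ : ℂ) t : ℝ) * Complex.I) =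
      Complex.exp ((t.re : ℂ) * p.1 * Complex.I) * Complex.exp ((t.im : ℂ) * p.2 * Complex.I) := by
    intro p
    rw [← Complex.exp_add, Complex.inner]
    congr 1
    simp only [Complex.mul_re, Complex.conj_re, Complex.conj_im]
    push_cast
    ring
  simp_rw [h1]
  rw [integral_prod_mul (fun x : ℝ => Complex.exp ((t.re : ℂ) * x * Complex.I))
    (fun x : ℝ => Complex.exp ((t.im : ℂ) * x * Complex.I)), ← charFun_apply_real,
    ← charFun_apply_real, charFun_gaussianReal, charFun_gaussianReal, ← Complex.exp_add]
  congr 1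
  have : (‖t‖ : ℂ) ^ 2 = (t.re : ℂ) ^ 2 + (t.im : ℂ) ^ 2 := by
    rw [← Complex.ofReal_pow, Complex.sq_norm, Complex.normSq_apply]
    push_cast
    ring
  rw [this]
  simp
  ring

/-- Under the standard complex Gaussian law, `‖z‖² / 2` is exponential with rate one. -/
theorem lintegral_stdComplexGaussian_norm_sq {f : ℝ → ℝ≥0∞} (hf : Measurable f) :
    ∫⁻ z, f (‖z‖ ^ 2 / 2) ∂stdComplexGaussian =
      ∫⁻ u in Set.Ioi (0 : ℝ), f u * ENNReal.ofReal (Real.exp (-u)) := by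
  have hm := measurable_complex_mk
  have hd : Measurable (gaussianPDF 0 1) := measurable_gaussianPDF 0 1
  have h0 : (1 : NNReal) ≠ 0 := one_ne_zero
  rw [stdComplexGaussian, lintegral_map (by fun_prop) hm, gaussianReal_of_var_ne_zero 0 h0,
    prod_withDensity hd hd, ← Measure.volume_eq_prod,
    lintegral_withDensity_eq_lintegral_mul _ (by fun_prop)
      (by simp only [Complex.sq_norm, Complex.normSq_mk]; fun_prop),
    ← lintegral_comp_polarCoord_symm]
  have hpt : ∀ p ∈ polarCoord.target, ENNReal.ofReal p.1 •
      ((fun z : ℝ × ℝ => gaussianPDF 0 1 z.1 * gaussianPDF 0 1 z.2) *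
        fun a : ℝ × ℝ => f (‖(⟨a.1, a.2⟩ : ℂ)‖ ^ 2 / 2)) (polarCoord.symm p) =
      (ENNReal.ofReal p.1 * (f (p.1 ^ 2 / 2) * ENNReal.ofReal (Real.exp (-(p.1 ^ 2 / 2))))) *
        ENNReal.ofReal ((2 * Real.pi)⁻¹) := by
    intro p hp
    have hp1 : 0 < p.1 := hp.1
    have e1 : (p.1 * Real.cos p.2) * (p.1 * Real.cos p.2) +
        (p.1 * Real.sin p.2) * (p.1 * Real.sin p.2) = p.1 ^ 2 := by
      have := Real.sin_sq_add_cos_sq p.2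
      linear_combination p.1 ^ 2 * this
    simp only [polarCoord_symm_apply, Pi.mul_apply, Complex.sq_norm, Complex.normSq_mk, e1,
      smul_eq_mul, gaussianPDF]
    rw [← ENNReal.ofReal_mul (gaussianPDFReal_nonneg _ _ _)]
    have e2 : gaussianPDFReal 0 1 (p.1 * Real.cos p.2) * gaussianPDFReal 0 1 (p.1 * Real.sin p.2) =
        Real.exp (-(p.1 ^ 2 / 2)) * (2 * Real.pi)⁻¹ := by
      simp only [gaussianPDFReal, NNReal.coe_one, mul_one, sub_zero]
      rw [mul_mul_mul_comm, ← Real.exp_add, ← mul_inv, Real.mul_self_sqrt (by positivity), mul_comm]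
      congr 2
      linear_combination (-1 / 2) * e1
    rw [e2, ENNReal.ofReal_mul (Real.exp_pos _).le]
    ring
  rw [setLIntegral_congr_fun polarCoord.open_target.measurableSet hpt,
    lintegral_mul_const _ (by fun_prop)]
  have htar : polarCoord.target = Set.Ioi (0 : ℝ) ×ˢ Set.Ioo (-Real.pi) Real.pi := rfl
  rw [htar, Measure.volume_eq_prod, ← Measure.prod_restrict,
    lintegral_prod _ (by fun_prop)]
  simp only [lintegral_const, Measure.restrict_apply MeasurableSet.univ, Set.univ_inter,
    Real.volume_Ioo]
  rw [lintegral_mul_const _ (by fun_prop), mul_assoc, ← ENNReal.ofReal_mul (by linarith [Real.pi_pos])]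
  have : (Real.pi - -Real.pi) * (2 * Real.pi)⁻¹ = 1 := by field_simp; ring
  rw [this, ENNReal.ofReal_one, mul_one]
  -- The substitution u = r²/2 turns the radial density r exp(-r²/2) dr into exp(-u) du.
  have himg : (fun r : ℝ => r ^ 2 / 2) '' Set.Ioi 0 = Set.Ioi 0 := by
    ext u
    simp only [Set.mem_image, Set.mem_Ioi]
    constructor
    · rintro ⟨r, hr, rfl⟩; positivity
    · intro hu
      exact ⟨√(2 * u), by positivity, by rw [Real.sq_sqrt (by positivity)]; ring⟩
  conv_rhs => rw [← himg]
  rw [lintegral_image_eq_lintegral_abs_deriv_mul (f := fun r : ℝ => r ^ 2 / 2)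
    (f' := fun r => r) measurableSet_Ioi]
  · refine setLIntegral_congr_fun measurableSet_Ioi fun r hr => ?_
    rw [abs_of_pos (Set.mem_Ioi.1 hr)]
  · intro r _
    have h1 : HasDerivAt (fun r : ℝ => r ^ 2 / 2) _ r := (hasDerivAt_pow 2 r).div_const 2
    exact (h1.congr_deriv (by simp)).hasDerivWithinAt
  · intro a ha b hb hab
    have ha' : (0 : ℝ) < a := ha
    have hb' : (0 : ℝ) < b := hb
    have hab' : a ^ 2 / 2 = b ^ 2 / 2 := hab
    nlinarith

theorem lintegral_exp_norm_sq_stdComplexGaussian {θ : ℝ} (hθ : 2 * θ < 1) :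
    ∫⁻ z, ENNReal.ofReal (Real.exp (θ * ‖z‖ ^ 2)) ∂stdComplexGaussian =
      ENNReal.ofReal ((1 - 2 * θ)⁻¹) := by
  have h := lintegral_stdComplexGaussian_norm_sq
    (f := fun u => ENNReal.ofReal (Real.exp (2 * θ * u))) (by fun_prop)
  have e : ∀ z : ℂ, 2 * θ * (‖z‖ ^ 2 / 2) = θ * ‖z‖ ^ 2 := fun z => by ring
  simp only [e] at h
  rw [h]
  have e2 : ∀ u : ℝ, ENNReal.ofReal (Real.exp (2 * θ * u)) * ENNReal.ofReal (Real.exp (-u)) =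
      ENNReal.ofReal (Real.exp (-(1 - 2 * θ) * u)) := fun u => by
    rw [← ENNReal.ofReal_mul (Real.exp_pos _).le, ← Real.exp_add]; congr 2; ring
  simp_rw [e2]
  have hneg : -(1 - 2 * θ) < 0 := by linarith
  rw [← ofReal_integral_eq_lintegral_ofReal (integrableOn_exp_mul_Ioi hneg 0)
    (Filter.Eventually.of_forall fun u => (Real.exp_pos _).le), integral_exp_mul_Ioi hneg 0]
  congr 1
  rw [mul_zero, Real.exp_zero, neg_div_neg_eq, one_div]

theorem lintegral_norm_sq_sub_stdComplexGaussian {a : ℝ} (ha : 0 ≤ a) :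
    ∫⁻ z, ENNReal.ofReal (‖z‖ ^ 2 / 2 - a) ∂stdComplexGaussian =
      ENNReal.ofReal (Real.exp (-a)) := by
  rw [lintegral_stdComplexGaussian_norm_sq (f := fun u => ENNReal.ofReal (u - a)) (by fun_prop)]
  have hind : ∀ u : ℝ, ENNReal.ofReal (u - a) * ENNReal.ofReal (Real.exp (-u)) =
      (Set.Ioi a).indicator (fun u => ENNReal.ofReal ((u - a) * Real.exp (-u))) u := by
    intro u
    by_cases hu : a < u
    · rw [Set.indicator_of_mem (Set.mem_Ioi.2 hu), ENNReal.ofReal_mul (by linarith)]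
    · rw [Set.indicator_of_notMem (by simpa using hu), ENNReal.ofReal_of_nonpos (by linarith),
        zero_mul]
  simp_rw [hind]
  rw [lintegral_indicator measurableSet_Ioi, Measure.restrict_restrict measurableSet_Ioi,
    Set.inter_eq_left.2 (Set.Ioi_subset_Ioi ha)]
  -- An antiderivative that vanishes at infinity and equals -exp(-a) at a.
  have hder : ∀ u ∈ Set.Ici a, HasDerivAt (fun u => -((u - a + 1) * Real.exp (-u)))
      ((u - a) * Real.exp (-u)) u := by
    intro u _
    have h1 : HasDerivAt (fun u => -((u - a + 1) * Real.exp (-u))) _ u :=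
      ((((hasDerivAt_id u).sub_const a).add_const 1).mul (hasDerivAt_neg u).exp).neg
    exact h1.congr_deriv (by simp only [id]; ring)
  have hnn : ∀ u ∈ Set.Ioi a, 0 ≤ (u - a) * Real.exp (-u) := fun u hu =>
    mul_nonneg (by linarith [Set.mem_Ioi.1 hu]) (Real.exp_pos _).le
  have hlim : Filter.Tendsto (fun u => -((u - a + 1) * Real.exp (-u))) Filter.atTop (nhds 0) := by
    have h1 := Real.tendsto_pow_mul_exp_neg_atTop_nhds_zero 1
    have h0 := Real.tendsto_pow_mul_exp_neg_atTop_nhds_zero 0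
    have h2 := (h1.add (h0.const_mul (1 - a))).neg
    simp only [mul_zero, add_zero, neg_zero] at h2
    refine h2.congr fun u => ?_
    ring
  rw [← ofReal_integral_eq_lintegral_ofReal (integrableOn_Ioi_deriv_of_nonneg' hder hnn hlim)
    ((ae_restrict_iff' measurableSet_Ioi).2 (Filter.Eventually.of_forall hnn)),
    integral_Ioi_of_hasDerivAt_of_nonneg' hder hnn hlim]
  congr 1
  simp

/-- The law of a vector of independent standard complex Gaussian variables. -/
def gaussianVec (ι : Type*) [Fintype ι] : Measure (EuclideanSpace ℂ ι) :=
  (Measure.pi fun _ : ι => stdComplexGaussian).map (WithLp.toLp 2)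

variable {ι κ : Type*} [Fintype ι] [Fintype κ]

instance : IsProbabilityMeasure (gaussianVec ι) :=
  Measure.isProbabilityMeasure_map (Measurable.aemeasurable (by fun_prop))

/-- The dependence on ‖t‖ alone expresses unitary invariance; this is what reduces linear
functionals to a single standard variable. -/
theorem charFun_gaussianVec (t : EuclideanSpace ℂ ι) :
    charFun (gaussianVec ι) t = Complex.exp (-(‖t‖ : ℂ) ^ 2 / 2) := by
  rw [gaussianVec, charFun_pi]
  simp_rw [charFun_stdComplexGaussian, ← Complex.exp_sum, ← Complex.ofReal_pow,
    EuclideanSpace.norm_sq_eq]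
  simp [Finset.sum_div, neg_div]

/-- A linear functional of a complex Gaussian vector is a multiple of a standard one. -/
theorem map_inner_gaussianVec (v : EuclideanSpace ℂ ι) :
    (gaussianVec ι).map (fun z => inner ℂ v z) =
      stdComplexGaussian.map (fun z => (‖v‖ : ℂ) * z) := by
  have : IsProbabilityMeasure ((gaussianVec ι).map (fun z => inner ℂ v z)) :=
    Measure.isProbabilityMeasure_map (Continuous.measurable (by fun_prop)).aemeasurable
  have : IsProbabilityMeasure (stdComplexGaussian.map (fun z => (‖v‖ : ℂ) * z)) :=
    Measure.isProbabilityMeasure_map (Continuous.measurable (by fun_prop)).aemeasurable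
  refine Measure.ext_of_charFun (funext fun t => ?_)
  have e1 : charFun ((gaussianVec ι).map (fun z => inner ℂ v z)) t =
      charFun (gaussianVec ι) (t • v) := by
    rw [charFun_apply, charFun_apply, integral_map (Continuous.measurable (by fun_prop)).aemeasurable
      (Continuous.aestronglyMeasurable (by fun_prop))]
    congr 1
    ext z
    congr 3
    simp only [PiLp.inner_apply, sum_inner, PiLp.smul_apply, smul_eq_mul, Complex.inner,
      RCLike.inner_apply, map_mul, Complex.conj_conj]
    refine Finset.sum_congr rfl fun i _ => ?_
    ring_nf
  have e2 : charFun (stdComplexGaussian.map (fun z => (‖v‖ : ℂ) * z)) t =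
      charFun stdComplexGaussian ((‖v‖ : ℂ) * t) := by
    rw [charFun_apply, charFun_apply, integral_map (Continuous.measurable (by fun_prop)).aemeasurable
      (Continuous.aestronglyMeasurable (by fun_prop))]
    congr 1
    ext z
    simp only [Complex.inner, map_mul, Complex.conj_ofReal]
    ring_nf
  rw [e1, e2, charFun_gaussianVec, charFun_stdComplexGaussian, norm_smul, norm_mul,
    Complex.norm_real, norm_norm]
  push_cast
  ring_nf

/-- Read from right to left, this linearizes the exponential of a squared norm at the price of
averaging over an auxiliary Gaussian vector. -/
theorem lintegral_exp_re_inner_gaussianVec (v : EuclideanSpace ℂ ι) :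
    ∫⁻ z, ENNReal.ofReal (Real.exp (inner ℂ v z).re) ∂gaussianVec ι =
      ENNReal.ofReal (Real.exp (‖v‖ ^ 2 / 2)) := by
  have h1 : ∫⁻ z, ENNReal.ofReal (Real.exp (inner ℂ v z).re) ∂gaussianVec ι =
      ∫⁻ w, ENNReal.ofReal (Real.exp w.re) ∂((gaussianVec ι).map (fun z => inner ℂ v z)) := by
    rw [lintegral_map (by fun_prop) (Continuous.measurable (by fun_prop))]
  rw [h1, map_inner_gaussianVec, lintegral_map (by fun_prop) (Continuous.measurable (by fun_prop)),
    stdComplexGaussian, lintegral_map (by fun_prop) measurable_complex_mk]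
  simp only [Complex.re_ofReal_mul]
  have h2 := lintegral_prod (μ := gaussianReal 0 1) (ν := gaussianReal 0 1)
    (fun p : ℝ × ℝ => ENNReal.ofReal (Real.exp (‖v‖ * p.1))) (by fun_prop)
  rw [h2]
  simp only [lintegral_const, measure_univ, mul_one]
  have h3 := mgf_fun_id_gaussianReal (μ := 0) (v := 1)
  rw [← ofReal_integral_eq_lintegral_ofReal (integrable_exp_mul_gaussianReal _)
    (Filter.Eventually.of_forall fun u => (Real.exp_pos _).le)]
  have h4 := congrFun h3 ‖v‖
  rw [mgf] at h4
  rw [h4]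
  simp

theorem lintegral_norm_sq_sub_gaussianVec_le {v : EuclideanSpace ℂ ι} (hv : ‖v‖ ≤ 1) {a : ℝ}
    (ha : 0 ≤ a) :
    ∫⁻ z, ENNReal.ofReal (‖inner ℂ v z‖ ^ 2 / 2 - a) ∂gaussianVec ι ≤
      ENNReal.ofReal (Real.exp (-a)) := by
  have h1 : ∫⁻ z, ENNReal.ofReal (‖inner ℂ v z‖ ^ 2 / 2 - a) ∂gaussianVec ι =
      ∫⁻ w, ENNReal.ofReal (‖w‖ ^ 2 / 2 - a) ∂((gaussianVec ι).map (fun z => inner ℂ v z)) := by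
    rw [lintegral_map (by fun_prop) (Continuous.measurable (by fun_prop))]
  rw [h1, map_inner_gaussianVec, lintegral_map (by fun_prop) (Continuous.measurable (by fun_prop)),
    ← lintegral_norm_sq_sub_stdComplexGaussian ha]
  refine lintegral_mono fun z => ENNReal.ofReal_le_ofReal ?_
  have : ‖(‖v‖ : ℂ) * z‖ ≤ ‖z‖ := by
    rw [norm_mul, Complex.norm_real, norm_norm]
    exact mul_le_of_le_one_left (norm_nonneg _) hv
  gcongr

/-- The moment generating function of a weighted sum of squared coordinates of a contraction of
a complex Gaussian vector is at most that of the same sum of squared independent variables. -/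
theorem lintegral_exp_sum_norm_sq_le (A : EuclideanSpace ℂ ι →L[ℂ] EuclideanSpace ℂ κ)
    (hA : ∀ z, ‖A z‖ ≤ ‖z‖) {c : κ → ℝ} (hc : ∀ j, 0 ≤ c j) (hc1 : ∀ j, 2 * c j < 1) :
    ∫⁻ z, ENNReal.ofReal (Real.exp (∑ j, c j * ‖A z j‖ ^ 2)) ∂gaussianVec ι ≤
      ENNReal.ofReal (∏ j, (1 - 2 * c j)⁻¹) := by
  -- With this diagonal map, ‖D (A z)‖²/2 is the exponent to be integrated. Linearizing it by an
  -- independent g and exchanging the integrals replaces A by its adjoint acting on D g. The adjoint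
  -- is also a contraction, so it can be dropped, and the coordinates of g are independent.
  let D : EuclideanSpace ℂ κ →L[ℂ] EuclideanSpace ℂ κ :=
    LinearMap.toContinuousLinearMap
      { toFun := fun g => WithLp.toLp 2 fun j => (√(2 * c j) : ℂ) * g j
        map_add' := fun g h => by ext j; simp [mul_add]
        map_smul' := fun a g => by ext j; simp; ring }
  have hD : ∀ g j, D g j = (√(2 * c j) : ℂ) * g j := fun g j => rfl
  have hDn : ∀ g, ‖D g‖ ^ 2 = ∑ j, 2 * (c j * ‖g j‖ ^ 2) := by
    intro g
    rw [EuclideanSpace.norm_sq_eq]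
    refine Finset.sum_congr rfl fun j _ => ?_
    rw [hD, norm_mul, Complex.norm_real, Real.norm_eq_abs, mul_pow, sq_abs,
      Real.sq_sqrt (by linarith [hc j])]
    ring
  have hadj : ∀ w, ‖A.adjoint w‖ ≤ ‖w‖ := by
    intro w
    have h1 : ‖A‖ ≤ 1 := A.opNorm_le_bound zero_le_one fun z => by simpa using hA z
    calc ‖A.adjoint w‖ ≤ ‖A.adjoint‖ * ‖w‖ := A.adjoint.le_opNorm w
      _ ≤ 1 * ‖w‖ := by
        gcongr
        rwa [LinearIsometryEquiv.norm_map]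
      _ = ‖w‖ := one_mul _
  have h1 : ∀ z, ENNReal.ofReal (Real.exp (∑ j, c j * ‖A z j‖ ^ 2)) =
      ∫⁻ g, ENNReal.ofReal (Real.exp (inner ℂ (D (A z)) g).re) ∂gaussianVec κ := by
    intro z
    rw [lintegral_exp_re_inner_gaussianVec, hDn, ← Finset.mul_sum]
    congr 2
    ring
  have h2 : ∀ z g, (inner ℂ (D (A z)) g).re = (inner ℂ (A.adjoint (D g)) z).re := by
    intro z g
    rw [ContinuousLinearMap.adjoint_inner_left, ← Complex.conj_re, inner_conj_symm]
    simp only [PiLp.inner_apply, hD]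
    congr 1
    refine Finset.sum_congr rfl fun j _ => ?_
    simp only [RCLike.inner_apply, map_mul, Complex.conj_ofReal]
    ring
  simp_rw [h1, h2]
  have hmeas : Measurable (Function.uncurry fun (z : EuclideanSpace ℂ ι) (g : EuclideanSpace ℂ κ) =>
      ENNReal.ofReal (Real.exp (inner ℂ (A.adjoint (D g)) z).re)) :=
    ENNReal.measurable_ofReal.comp (Continuous.measurable (by fun_prop))
  rw [lintegral_lintegral_swap hmeas.aemeasurable]
  simp_rw [lintegral_exp_re_inner_gaussianVec]
  calc ∫⁻ g, ENNReal.ofReal (Real.exp (‖A.adjoint (D g)‖ ^ 2 / 2)) ∂gaussianVec κ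
      ≤ ∫⁻ g, ∏ j, ENNReal.ofReal (Real.exp (c j * ‖g j‖ ^ 2)) ∂gaussianVec κ := by
        refine lintegral_mono fun g => ?_
        rw [← ENNReal.ofReal_prod_of_nonneg fun j _ => (Real.exp_pos _).le, ← Real.exp_sum]
        refine ENNReal.ofReal_le_ofReal (Real.exp_le_exp.2 ?_)
        have h3 : ‖A.adjoint (D g)‖ ^ 2 ≤ ‖D g‖ ^ 2 := by gcongr; exact hadj _
        rw [hDn, ← Finset.mul_sum] at h3
        linarith
    _ = ∏ j, ∫⁻ w, ENNReal.ofReal (Real.exp (c j * ‖w‖ ^ 2)) ∂stdComplexGaussian := by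
        rw [gaussianVec, lintegral_map (by fun_prop) (by fun_prop),
          lintegral_prod_eq_prod_lintegral_of_indepFun Finset.univ
          (fun j (g : κ → ℂ) => ENNReal.ofReal (Real.exp (c j * ‖g j‖ ^ 2)))
          (iIndepFun_pi (μ := fun _ : κ => stdComplexGaussian)
            (X := fun j w => ENNReal.ofReal (Real.exp (c j * ‖w‖ ^ 2)))
            fun j => Measurable.aemeasurable (by fun_prop)) (fun j => by fun_prop)]
        refine Finset.prod_congr rfl fun j _ => ?_
        exact (measurePreserving_eval (fun _ : κ => stdComplexGaussian) j).lintegral_comp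
          (f := fun w : ℂ => ENNReal.ofReal (Real.exp (c j * ‖w‖ ^ 2))) (by fun_prop)
    _ = _ := by
        rw [ENNReal.ofReal_prod_of_nonneg fun j _ => inv_nonneg.2 (by linarith [hc1 j])]
        exact Finset.prod_congr rfl fun j _ => lintegral_exp_norm_sq_stdComplexGaussian (hc1 j)

end Gaussian

/-! ### Tail bounds and exponential moments of quadratic forms. -/

section Tails

variable {ι κ : Type*} [Fintype ι] [Fintype κ]

/-- The exponential Chebyshev inequality in terms of the lower Lebesgue integral. -/
theorem measure_gt_le_of_lintegral_exp_le {Ω : Type*} [MeasurableSpace Ω] {μ : Measure Ω}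
    {X : Ω → ℝ} (hX : Measurable X) {l K u : ℝ} (hl : 0 ≤ l)
    (h : ∫⁻ z, ENNReal.ofReal (Real.exp (l * X z)) ∂μ ≤ ENNReal.ofReal (Real.exp K)) :
    μ {z | u < X z} ≤ ENNReal.ofReal (Real.exp (K - l * u)) := by
  have hpos : ENNReal.ofReal (Real.exp (l * u)) ≠ 0 := by
    simpa using Real.exp_pos (l * u)
  calc μ {z | u < X z}
      ≤ μ {z | ENNReal.ofReal (Real.exp (l * u)) ≤ ENNReal.ofReal (Real.exp (l * X z))} := by
        refine measure_mono fun z hz => ENNReal.ofReal_le_ofReal (Real.exp_le_exp.2 ?_)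
        exact mul_le_mul_of_nonneg_left (le_of_lt hz) hl
    _ ≤ (∫⁻ z, ENNReal.ofReal (Real.exp (l * X z)) ∂μ) / ENNReal.ofReal (Real.exp (l * u)) :=
        meas_ge_le_lintegral_div (Measurable.aemeasurable (by fun_prop)) hpos ENNReal.ofReal_ne_top
    _ ≤ ENNReal.ofReal (Real.exp K) / ENNReal.ofReal (Real.exp (l * u)) := by gcongr
    _ = ENNReal.ofReal (Real.exp (K - l * u)) := by
        rw [← ENNReal.ofReal_div_of_pos (Real.exp_pos _), ← Real.exp_sub]

/-- A Chernoff bound for ‖A z‖², whose exponential moment is at most (1 - 2θ)^(-s). -/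
theorem gaussianVec_norm_gt_le (A : EuclideanSpace ℂ ι →L[ℂ] EuclideanSpace ℂ κ)
    (hA : ∀ z, ‖A z‖ ≤ ‖z‖) {s : ℕ} (hs : 1 ≤ s) (hκ : Fintype.card κ ≤ s) {c : ℝ} (hc : 0 ≤ c) :
    gaussianVec ι {z | √(2 * s) + c < ‖A z‖} ≤ ENNReal.ofReal (Real.exp (-(c ^ 2 / 2))) := by
  have hs' : (1 : ℝ) ≤ s := by exact_mod_cast hs
  set b : ℝ := √(2 * s) with hb
  have hb0 : 0 < b := by positivity
  have hb2 : b ^ 2 = 2 * s := Real.sq_sqrt (by positivity)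
  obtain ⟨x, hx⟩ : ∃ x, x = c / b := ⟨_, rfl⟩
  have hx0 : 0 ≤ x := by rw [hx]; positivity
  have hcx : c = b * x := by rw [hx]; field_simp
  -- With x = c/√(2s), this choice makes 1 - 2θ = (1 + x)⁻². The moment is then at most exp(2sx),
  -- while θ(√(2s) + c)² = s(2x + x²); the difference of exponents is -sx² = -c²/2.
  obtain ⟨θ, hθ⟩ : ∃ θ, θ = (1 - ((1 + x) ^ 2)⁻¹) / 2 := ⟨_, rfl⟩
  have h2θ : 1 - 2 * θ = ((1 + x) ^ 2)⁻¹ := by rw [hθ]; ring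
  have hinv : 0 < ((1 + x) ^ 2)⁻¹ := by positivity
  have hinv1 : ((1 + x) ^ 2)⁻¹ ≤ 1 := inv_le_one_of_one_le₀ (by nlinarith)
  have hθ0 : 0 ≤ θ := by rw [hθ]; linarith
  have h1 := lintegral_exp_sum_norm_sq_le A hA (c := fun _ => θ) (fun _ => hθ0)
    (fun _ => by linarith)
  simp only [← Finset.mul_sum, ← EuclideanSpace.norm_sq_eq, Finset.prod_const, h2θ, inv_inv,
    Finset.card_univ] at h1
  have h2 : ((1 + x) ^ 2) ^ Fintype.card κ ≤ Real.exp (2 * s * x) := by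
    calc ((1 + x) ^ 2) ^ Fintype.card κ ≤ ((1 + x) ^ 2) ^ s :=
          pow_le_pow_right₀ (by nlinarith) hκ
      _ ≤ ((Real.exp x) ^ 2) ^ s := by gcongr; linarith [Real.add_one_le_exp x]
      _ = Real.exp (2 * s * x) := by
          rw [← pow_mul, ← Real.exp_nat_mul]; push_cast; rfl
  have h3 := measure_gt_le_of_lintegral_exp_le (X := fun z => ‖A z‖ ^ 2)
    (u := (b + c) ^ 2) (by fun_prop) hθ0 (h1.trans (ENNReal.ofReal_le_ofReal h2))
  refine (measure_mono fun z hz => ?_).trans (h3.trans (ENNReal.ofReal_le_ofReal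
    (Real.exp_le_exp.2 (le_of_eq ?_))))
  · have hz' : b + c < ‖A z‖ := hz
    exact pow_lt_pow_left₀ hz' (by positivity) two_ne_zero
  · have h4 : θ * (b + c) ^ 2 = s * (2 * x + x ^ 2) := by
      have : ((1 + x) ^ 2)⁻¹ * (1 + x) ^ 2 = 1 := inv_mul_cancel₀ (by positivity)
      rw [hcx, hθ]
      linear_combination (-(b ^ 2) / 2) * this + (x + x ^ 2 / 2) * hb2
    rw [h4, hcx]
    linear_combination (x ^ 2 / 2) * hb2

/-- The summands may be dependent. If the mean of the variables ‖⟨w_j, z⟩‖²/2 exceeds L, then the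
mean of their excesses over L - 1 is at least one. Each positive part of an excess has expectation
at most exp(1 - L), so Markov's inequality suffices and the number of terms does not enter. -/
theorem gaussianVec_sum_norm_inner_sq_gt_le [Nonempty κ] (v : κ → EuclideanSpace ℂ ι) {r L : ℝ}
    (hr : 0 ≤ r) (hv : ∀ j, ‖v j‖ ≤ r) (hL : 1 ≤ L) :
    gaussianVec ι {z | Fintype.card κ * r ^ 2 * (2 * L) < ∑ j, ‖inner ℂ (v j) z‖ ^ 2} ≤
      ENNReal.ofReal (Real.exp (1 - L)) := by
  rcases hr.eq_or_lt with rfl | hr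
  · have : ∀ j, v j = 0 := fun j => norm_le_zero_iff.1 (hv j)
    simp [this]
  set M : ℝ := (Fintype.card κ : ℝ) with hM
  have hM0 : 0 < M := by rw [hM]; exact_mod_cast Fintype.card_pos
  set w : κ → EuclideanSpace ℂ ι := fun j => ((r : ℂ)⁻¹) • v j with hw
  have hw1 : ∀ j, ‖w j‖ ≤ 1 := fun j => by
    rw [hw, norm_smul, norm_inv, Complex.norm_real, Real.norm_of_nonneg hr.le]
    rw [inv_mul_le_iff₀ hr]; simpa using hv j
  have hwz : ∀ j z, ‖inner ℂ (w j) z‖ ^ 2 = ‖inner ℂ (v j) z‖ ^ 2 / r ^ 2 := fun j z => by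
    rw [hw, inner_smul_left, norm_mul, RCLike.norm_conj, norm_inv, Complex.norm_real,
      Real.norm_of_nonneg hr.le]
    field_simp
  set g : EuclideanSpace ℂ ι → ℝ≥0∞ :=
    fun z => ∑ j, ENNReal.ofReal M⁻¹ * ENNReal.ofReal (‖inner ℂ (w j) z‖ ^ 2 / 2 - (L - 1)) with hg
  have hmj : ∀ j, Measurable fun z : EuclideanSpace ℂ ι =>
      ENNReal.ofReal (‖inner ℂ (w j) z‖ ^ 2 / 2 - (L - 1)) := fun j =>
    ENNReal.measurable_ofReal.comp (Continuous.measurable (by fun_prop))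
  have hgm : Measurable g := by
    refine Finset.measurable_sum _ fun j _ => (hmj j).const_mul _
  calc gaussianVec ι {z | M * r ^ 2 * (2 * L) < ∑ j, ‖inner ℂ (v j) z‖ ^ 2}
      ≤ gaussianVec ι {z | 1 ≤ g z} := by
        refine measure_mono fun z hz => ?_
        have hz' : M * r ^ 2 * (2 * L) < ∑ j, ‖inner ℂ (v j) z‖ ^ 2 := hz
        have h1 : (1 : ℝ) ≤ ∑ j, M⁻¹ * (‖inner ℂ (w j) z‖ ^ 2 / 2 - (L - 1)) := by
          rw [← Finset.mul_sum, Finset.sum_sub_distrib]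
          simp only [hwz, Finset.sum_const, Finset.card_univ, nsmul_eq_mul, ← Finset.sum_div]
          rw [← hM, le_inv_mul_iff₀ hM0]
          have : M * (2 * L) < (∑ j, ‖inner ℂ (v j) z‖ ^ 2) / r ^ 2 := by
            rw [lt_div_iff₀ (by positivity)]; linarith
          linarith
        calc (1 : ℝ≥0∞) = ENNReal.ofReal 1 := by simp
          _ ≤ ENNReal.ofReal (∑ j, M⁻¹ * (‖inner ℂ (w j) z‖ ^ 2 / 2 - (L - 1))) :=
            ENNReal.ofReal_le_ofReal h1
          _ ≤ ∑ j, ENNReal.ofReal (M⁻¹ * (‖inner ℂ (w j) z‖ ^ 2 / 2 - (L - 1))) :=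
            Finset.le_sum_of_subadditive _ ENNReal.ofReal_zero.le (fun _ _ => ENNReal.ofReal_add_le) _ _
          _ = g z := Finset.sum_congr rfl fun j _ => ENNReal.ofReal_mul (by positivity)
    _ ≤ (∫⁻ z, g z ∂gaussianVec ι) / 1 :=
        meas_ge_le_lintegral_div hgm.aemeasurable one_ne_zero ENNReal.one_ne_top
    _ = ∑ j, ENNReal.ofReal M⁻¹ *
          ∫⁻ z, ENNReal.ofReal (‖inner ℂ (w j) z‖ ^ 2 / 2 - (L - 1)) ∂gaussianVec ι := by
        rw [div_one, hg, lintegral_finsetSum _ fun j _ => (hmj j).const_mul _]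
        exact Finset.sum_congr rfl fun j _ => lintegral_const_mul _ (hmj j)
    _ ≤ ∑ j : κ, ENNReal.ofReal M⁻¹ * ENNReal.ofReal (Real.exp (1 - L)) := by
        gcongr with j
        refine (lintegral_norm_sq_sub_gaussianVec_le (hw1 j) (by linarith)).trans_eq ?_
        rw [neg_sub]
    _ = ENNReal.ofReal (Real.exp (1 - L)) := by
        rw [Finset.sum_const, Finset.card_univ, nsmul_eq_mul, ← mul_assoc,
          ← ENNReal.ofReal_natCast, ← ENNReal.ofReal_mul (by positivity), ← hM,
          mul_inv_cancel₀ hM0.ne', ENNReal.ofReal_one, one_mul]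

/-- For 0 ≤ c ≤ 1/4 one has (1 - 2c)(1 + 4c) ≥ 1, hence (1 - 2c)⁻¹ ≤ exp(4c). -/
theorem lintegral_exp_sum_norm_sq_le_exp (A : EuclideanSpace ℂ ι →L[ℂ] EuclideanSpace ℂ κ)
    (hA : ∀ z, ‖A z‖ ≤ ‖z‖) {c : κ → ℝ} (hc : ∀ j, 0 ≤ c j) (hc1 : ∀ j, c j ≤ 1 / 4) :
    ∫⁻ z, ENNReal.ofReal (Real.exp (∑ j, c j * ‖A z j‖ ^ 2)) ∂gaussianVec ι ≤
      ENNReal.ofReal (Real.exp (4 * ∑ j, c j)) := by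
  refine (lintegral_exp_sum_norm_sq_le A hA hc fun j => by linarith [hc1 j]).trans
    (ENNReal.ofReal_le_ofReal ?_)
  rw [Finset.mul_sum, Real.exp_sum]
  refine Finset.prod_le_prod (fun j _ => inv_nonneg.2 (by linarith [hc1 j])) fun j _ => ?_
  have h0 := hc j
  have h1 := hc1 j
  refine inv_le_of_inv_le₀ (Real.exp_pos _) ?_
  rw [inv_le_iff_one_le_mul₀ (Real.exp_pos _)]
  nlinarith [Real.add_one_le_exp (4 * c j)]

/-- Exponential moments of a form dominated by a weighted sum of squared coordinates of two
contractions of a complex Gaussian vector. -/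
theorem lintegral_exp_le_of_le_sum (A B : EuclideanSpace ℂ ι →L[ℂ] EuclideanSpace ℂ κ)
    (hA : ∀ z, ‖A z‖ ≤ ‖z‖) (hB : ∀ z, ‖B z‖ ≤ ‖z‖) {c : κ → ℝ} (hc : ∀ j, 0 ≤ c j)
    {X : EuclideanSpace ℂ ι → ℝ} (hX : ∀ z, X z ≤ ∑ j, c j * ((‖A z j‖ ^ 2 + ‖B z j‖ ^ 2) / 2))
    {l K : ℝ} (hl : 0 ≤ l) (hc1 : ∀ j, l * c j ≤ 1 / 4) (hK : 4 * l * ∑ j, c j ≤ K) :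
    ∫⁻ z, ENNReal.ofReal (Real.exp (l * X z)) ∂gaussianVec ι ≤ ENNReal.ofReal (Real.exp K) := by
  have hlc : ∀ j, 0 ≤ l * c j := fun j => mul_nonneg hl (hc j)
  -- A z and B z are dependent in general; convexity of exp separates them without any joint
  -- information.
  have e : ∀ a b : ℝ, Real.exp ((a + b) / 2) ≤ 2⁻¹ * Real.exp a + 2⁻¹ * Real.exp b := fun a b => by
    have h1 : Real.exp a = Real.exp (a / 2) ^ 2 := by rw [← Real.exp_nat_mul]; congr 1; push_cast; ring
    have h2 : Real.exp b = Real.exp (b / 2) ^ 2 := by rw [← Real.exp_nat_mul]; congr 1; push_cast; ring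
    rw [add_div, Real.exp_add, h1, h2]
    nlinarith [sq_nonneg (Real.exp (a / 2) - Real.exp (b / 2))]
  calc ∫⁻ z, ENNReal.ofReal (Real.exp (l * X z)) ∂gaussianVec ι
      ≤ ∫⁻ z, (ENNReal.ofReal 2⁻¹ * ENNReal.ofReal (Real.exp (∑ j, l * c j * ‖A z j‖ ^ 2)) +
          ENNReal.ofReal 2⁻¹ * ENNReal.ofReal (Real.exp (∑ j, l * c j * ‖B z j‖ ^ 2)))
          ∂gaussianVec ι := by
        refine lintegral_mono fun z => ?_
        rw [← ENNReal.ofReal_mul (by norm_num), ← ENNReal.ofReal_mul (by norm_num),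
          ← ENNReal.ofReal_add (by positivity) (by positivity)]
        refine ENNReal.ofReal_le_ofReal (le_trans (Real.exp_le_exp.2 ?_) (e _ _))
        refine (mul_le_mul_of_nonneg_left (hX z) hl).trans_eq ?_
        rw [← Finset.sum_add_distrib, Finset.mul_sum, Finset.sum_div]
        exact Finset.sum_congr rfl fun j _ => by ring
    _ ≤ ENNReal.ofReal 2⁻¹ * ENNReal.ofReal (Real.exp (4 * ∑ j, l * c j)) +
          ENNReal.ofReal 2⁻¹ * ENNReal.ofReal (Real.exp (4 * ∑ j, l * c j)) := by
        rw [lintegral_add_left (by fun_prop), lintegral_const_mul _ (by fun_prop),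
          lintegral_const_mul _ (by fun_prop)]
        gcongr
        · exact lintegral_exp_sum_norm_sq_le_exp A hA hlc hc1
        · exact lintegral_exp_sum_norm_sq_le_exp B hB hlc hc1
    _ ≤ ENNReal.ofReal (Real.exp K) := by
        rw [← add_mul, ← ENNReal.ofReal_add (by norm_num) (by norm_num)]
        rw [← Finset.mul_sum, ← mul_assoc]
        norm_num
        exact ENNReal.ofReal_le_ofReal (Real.exp_le_exp.2 hK)

/-- Jensen's inequality for the exponential moment of a sum of three terms. -/
theorem lintegral_exp_add_three_le {Ω : Type*} [MeasurableSpace Ω] {μ : Measure Ω}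
    {X Y Z : Ω → ℝ} (hX : Measurable X) (hY : Measurable Y) (hZ : Measurable Z) {l K : ℝ}
    (h1 : ∫⁻ z, ENNReal.ofReal (Real.exp (3 * l * X z)) ∂μ ≤ ENNReal.ofReal (Real.exp K))
    (h2 : ∫⁻ z, ENNReal.ofReal (Real.exp (3 * l * Y z)) ∂μ ≤ ENNReal.ofReal (Real.exp K))
    (h3 : ∫⁻ z, ENNReal.ofReal (Real.exp (3 * l * Z z)) ∂μ ≤ ENNReal.ofReal (Real.exp K)) :
    ∫⁻ z, ENNReal.ofReal (Real.exp (l * (X z + Y z + Z z))) ∂μ ≤ ENNReal.ofReal (Real.exp K) := by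
  have e : ∀ x y z : ℝ, Real.exp (l * (x + y + z)) ≤
      3⁻¹ * Real.exp (3 * l * x) + 3⁻¹ * Real.exp (3 * l * y) + 3⁻¹ * Real.exp (3 * l * z) := by
    intro x y z
    set w := l * (x + y + z) with hw
    have key : ∀ t : ℝ, Real.exp w * (t - w + 1) ≤ Real.exp t := fun t => by
      have h := mul_le_mul_of_nonneg_left (Real.add_one_le_exp (t - w)) (Real.exp_pos w).le
      rwa [← Real.exp_add, add_sub_cancel] at h
    have a1 := key (3 * l * x)
    have a2 := key (3 * l * y)
    have a3 := key (3 * l * z)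
    have : Real.exp w * (3 * l * x - w + 1) + Real.exp w * (3 * l * y - w + 1) +
        Real.exp w * (3 * l * z - w + 1) = 3 * Real.exp w := by rw [hw]; ring
    linarith
  calc ∫⁻ z, ENNReal.ofReal (Real.exp (l * (X z + Y z + Z z))) ∂μ
      ≤ ∫⁻ z, (ENNReal.ofReal 3⁻¹ * ENNReal.ofReal (Real.exp (3 * l * X z)) +
          ENNReal.ofReal 3⁻¹ * ENNReal.ofReal (Real.exp (3 * l * Y z)) +
          ENNReal.ofReal 3⁻¹ * ENNReal.ofReal (Real.exp (3 * l * Z z))) ∂μ := by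
        refine lintegral_mono fun z => ?_
        rw [← ENNReal.ofReal_mul (by norm_num), ← ENNReal.ofReal_mul (by norm_num),
          ← ENNReal.ofReal_mul (by norm_num), ← ENNReal.ofReal_add (by positivity) (by positivity),
          ← ENNReal.ofReal_add (by positivity) (by positivity)]
        exact ENNReal.ofReal_le_ofReal (e _ _ _)
    _ ≤ ENNReal.ofReal 3⁻¹ * ENNReal.ofReal (Real.exp K) +
          ENNReal.ofReal 3⁻¹ * ENNReal.ofReal (Real.exp K) +
          ENNReal.ofReal 3⁻¹ * ENNReal.ofReal (Real.exp K) := by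
        rw [lintegral_add_left (by fun_prop), lintegral_add_left (by fun_prop),
          lintegral_const_mul _ (by fun_prop), lintegral_const_mul _ (by fun_prop),
          lintegral_const_mul _ (by fun_prop)]
        gcongr
    _ = ENNReal.ofReal (Real.exp K) := by
        rw [← add_mul, ← add_mul, ← ENNReal.ofReal_add (by norm_num) (by norm_num),
          ← ENNReal.ofReal_add (by norm_num) (by norm_num)]
        norm_num

end Tails

/-! ### Fourier modes, Dirichlet kernels and circulant embedding of band kernels. -/

section Fourier

/-- The exponential `t ↦ e^{2πiat/N}`. -/
def expMode (N a : ℕ) (t : ℤ) : ℂ :=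
  Complex.exp (2 * Real.pi * Complex.I * (a : ℂ) * (t : ℂ) / (N : ℂ))

theorem expMode_eq_exp_ofReal (N a : ℕ) (t : ℤ) :
    expMode N a t = Complex.exp (((2 * Real.pi * a * t / N : ℝ) : ℂ) * Complex.I) := by
  unfold expMode
  congr 1
  push_cast
  ring

@[simp]
theorem norm_expMode (N a : ℕ) (t : ℤ) : ‖expMode N a t‖ = 1 := by
  rw [expMode_eq_exp_ofReal, Complex.norm_exp_ofReal_mul_I]

theorem expMode_add (N a : ℕ) (t u : ℤ) : expMode N a (t + u) = expMode N a t * expMode N a u := by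
  unfold expMode
  rw [← Complex.exp_add]
  congr 1
  push_cast
  ring

theorem conj_expMode (N a : ℕ) (t : ℤ) : (starRingEnd ℂ) (expMode N a t) = expMode N a (-t) := by
  rw [expMode_eq_exp_ofReal, expMode_eq_exp_ofReal, ← Complex.exp_conj]
  congr 1
  rw [map_mul, Complex.conj_ofReal, Complex.conj_I]
  push_cast
  ring

theorem expMode_eq_pow (N a : ℕ) (t : ℤ) : expMode N a t = expMode N 1 t ^ a := by
  unfold expMode
  rw [← Complex.exp_nat_mul]
  congr 1
  push_cast
  ring

theorem expMode_one_eq_one_iff {N : ℕ} (hN : N ≠ 0) (t : ℤ) :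
    expMode N 1 t = 1 ↔ (N : ℤ) ∣ t := by
  have hN' : (N : ℂ) ≠ 0 := by exact_mod_cast hN
  unfold expMode
  rw [Complex.exp_eq_one_iff]
  have hpi : (2 * Real.pi * Complex.I : ℂ) ≠ 0 := Complex.two_pi_I_ne_zero
  constructor
  · rintro ⟨k, hk⟩
    refine ⟨k, ?_⟩
    have : (t : ℂ) = N * k := by
      field_simp at hk
      have h2 : (2 * Real.pi * Complex.I : ℂ) * t = (2 * Real.pi * Complex.I : ℂ) * (N * k) := by
        simp only [Nat.cast_one] at hk
        linear_combination (2 * Real.pi * Complex.I : ℂ) * hk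
      exact mul_left_cancel₀ hpi h2
    exact_mod_cast this
  · rintro ⟨k, rfl⟩
    refine ⟨k, ?_⟩
    push_cast
    field_simp

theorem sum_expMode {N : ℕ} (hN : N ≠ 0) (t : ℤ) :
    ∑ a ∈ Finset.range N, expMode N a t = if (N : ℤ) ∣ t then (N : ℂ) else 0 := by
  rw [Finset.sum_congr rfl fun a _ => expMode_eq_pow N a t]
  split_ifs with h
  · simp [(expMode_one_eq_one_iff hN t).2 h]
  · have h1 : expMode N 1 t ≠ 1 := fun h' => h ((expMode_one_eq_one_iff hN t).1 h')
    rw [geom_sum_eq h1, ← expMode_eq_pow]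
    have : expMode N N t = 1 := by
      have := (expMode_one_eq_one_iff hN (N * t)).2 (dvd_mul_right _ _)
      rw [← this]
      unfold expMode
      congr 1
      push_cast
      ring
    rw [this, sub_self, zero_div]

/-- The discrete Fourier transform of order `N` of a sequence restricted to `I`. -/
def partialDFT (N : ℕ) (I : Finset ℤ) (u : Signal) (a : ℕ) : ℂ :=
  ((√(N : ℝ))⁻¹ : ℝ) * ∑ t ∈ I, expMode N a (-t) * u t

/-- Parseval's identity; the points of I only have to be distinct modulo N, so I need not be {0, …,
N - 1}. -/
theorem sum_norm_partialDFT_sq {N : ℕ} (hN : N ≠ 0) {I : Finset ℤ}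
    (hI : ∀ t ∈ I, ∀ t' ∈ I, (N : ℤ) ∣ t - t' → t = t') (u : Signal) :
    ∑ a ∈ Finset.range N, ‖partialDFT N I u a‖ ^ 2 = ∑ t ∈ I, ‖u t‖ ^ 2 := by
  have hN0 : (0 : ℝ) < N := by positivity
  have hN' : (N : ℂ) ≠ 0 := by exact_mod_cast hN
  have hs : (((√(N : ℝ))⁻¹ : ℝ) : ℂ) * (((√(N : ℝ))⁻¹ : ℝ) : ℂ) = (N : ℂ)⁻¹ := by
    rw [← Complex.ofReal_mul, ← mul_inv, Real.mul_self_sqrt hN0.le]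
    push_cast
    rfl
  have key : ((∑ a ∈ Finset.range N, ‖partialDFT N I u a‖ ^ 2 : ℝ) : ℂ) =
      ((∑ t ∈ I, ‖u t‖ ^ 2 : ℝ) : ℂ) := by
    push_cast
    have h1 : ∀ a, (‖partialDFT N I u a‖ : ℂ) ^ 2 =
        ∑ t ∈ I, ∑ t' ∈ I, (N : ℂ)⁻¹ * (u t * (starRingEnd ℂ) (u t')) * expMode N a (t' - t) := by
      intro a
      rw [← Complex.mul_conj', partialDFT, map_mul, Complex.conj_ofReal, map_sum,
        mul_mul_mul_comm, hs, Finset.sum_mul_sum, Finset.mul_sum]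
      refine Finset.sum_congr rfl fun t _ => ?_
      rw [Finset.mul_sum]
      refine Finset.sum_congr rfl fun t' _ => ?_
      rw [map_mul, conj_expMode, neg_neg, sub_eq_add_neg, expMode_add]
      ring
    simp_rw [h1]
    rw [Finset.sum_comm]
    refine Finset.sum_congr rfl fun t ht => ?_
    rw [Finset.sum_comm]
    have h2 : ∀ t' ∈ I, ∑ a ∈ Finset.range N,
        (N : ℂ)⁻¹ * (u t * (starRingEnd ℂ) (u t')) * expMode N a (t' - t) =
        if t' = t then (‖u t‖ : ℂ) ^ 2 else 0 := by
      intro t' ht'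
      rw [← Finset.mul_sum, sum_expMode hN]
      by_cases h : t' = t
      · subst h
        rw [if_pos rfl, sub_self, if_pos (dvd_zero _), Complex.mul_conj']
        field_simp
      · rw [if_neg h, if_neg (fun hd => h (hI t' ht' t ht hd)), mul_zero]
    rw [Finset.sum_congr rfl h2, Finset.sum_ite_eq' I t, if_pos ht]
  exact_mod_cast key

/-- The Dirichlet kernel of length `l` at the frequency `a / N`. -/
def boxDFT (N l a : ℕ) : ℂ := ∑ τ ∈ Finset.range l, expMode N a (-(τ : ℤ))

theorem norm_boxDFT_le (N l a : ℕ) : ‖boxDFT N l a‖ ≤ l := by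
  refine (norm_sum_le _ _).trans ?_
  simp

/-- The geometric sum is at most 1/sin(πa/N), and Jordan's inequality bounds the sine below by twice
the distance from a/N to the nearest integer. The sum of two reciprocals replaces a maximum, so that
the sum over a is harmonic. -/
theorem norm_boxDFT_le_inv {N l a : ℕ} (ha : 0 < a) (haN : a < N) :
    ‖boxDFT N l a‖ ≤ N / 2 * (1 / a + 1 / (N - a : ℕ)) := by
  have hN0 : (0 : ℝ) < N := by exact_mod_cast ha.trans haN
  have ha0 : (0 : ℝ) < a := by exact_mod_cast ha
  have hNa : (0 : ℝ) < (N - a : ℕ) := by exact_mod_cast Nat.sub_pos_of_lt haN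
  have hNa' : ((N - a : ℕ) : ℝ) = N - a := Nat.cast_sub haN.le
  set x : ℝ := Real.pi * a / N with hx
  have hsin : min (2 * (a : ℝ) / N) (2 * (N - a : ℕ) / N) ≤ Real.sin x := by
    rcases le_total x (Real.pi / 2) with h | h
    · refine (min_le_left _ _).trans ?_
      refine le_trans (le_of_eq ?_) (Real.mul_le_sin (by positivity) h)
      rw [hx]; field_simp
    · refine (min_le_right _ _).trans ?_
      rw [← Real.sin_pi_sub]
      have hle : x ≤ Real.pi := by
        rw [hx, div_le_iff₀ hN0]
        have : (a : ℝ) ≤ N := by exact_mod_cast haN.le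
        gcongr
      refine le_trans (le_of_eq ?_) (Real.mul_le_sin (by linarith) (by linarith))
      rw [hx, hNa']; field_simp
  have hsin0 : 0 < Real.sin x := lt_of_lt_of_le (lt_min (by positivity) (by positivity)) hsin
  have hw : ‖expMode N a (-1) - 1‖ = 2 * Real.sin x := by
    have : expMode N a (-1) = Complex.exp (Complex.I * ((-(2 * x) : ℝ) : ℂ)) := by
      rw [expMode_eq_exp_ofReal, mul_comm]
      congr 3
      rw [hx]; ring
    rw [this, Complex.norm_exp_I_mul_ofReal_sub_one, neg_div, mul_div_cancel_left₀ _ two_ne_zero,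
      Real.sin_neg, Real.norm_eq_abs, mul_neg, abs_neg, abs_of_pos (by positivity)]
  have hne : expMode N a (-1) ≠ 1 := fun h => by
    rw [h, sub_self, norm_zero] at hw; linarith
  have hpow : ∀ τ : ℕ, expMode N a (-(τ : ℤ)) = expMode N a (-1) ^ τ := fun τ => by
    unfold expMode
    rw [← Complex.exp_nat_mul]
    congr 1
    push_cast
    ring
  have hle2 : ‖expMode N a (-1) ^ l - 1‖ ≤ 2 := by
    refine (norm_sub_le _ _).trans ?_
    rw [norm_pow, norm_expMode, one_pow, norm_one]; norm_num
  unfold boxDFT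
  simp_rw [hpow]
  rw [geom_sum_eq hne, norm_div, hw]
  calc ‖expMode N a (-1) ^ l - 1‖ / (2 * Real.sin x) ≤ 2 / (2 * Real.sin x) := by gcongr
    _ = 1 / Real.sin x := by field_simp
    _ ≤ 1 / min (2 * (a : ℝ) / N) (2 * (N - a : ℕ) / N) := by
        gcongr
    _ ≤ N / 2 * (1 / a + 1 / (N - a : ℕ)) := by
        rcases min_choice (2 * (a : ℝ) / N) (2 * (N - a : ℕ) / N) with h | h <;> rw [h]
        · have : (1 : ℝ) / (2 * a / N) = N / 2 * (1 / a) := by field_simp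
          rw [this]
          gcongr
          linarith [div_pos one_pos hNa]
        · have : (1 : ℝ) / (2 * (N - a : ℕ) / N) = N / 2 * (1 / (N - a : ℕ)) := by field_simp
          rw [this]
          gcongr
          linarith [div_pos one_pos ha0]

theorem sum_norm_boxDFT_le {N : ℕ} (hN : N ≠ 0) (l : ℕ) :
    ∑ a ∈ Finset.range N, ‖boxDFT N l a‖ ≤ l + N * (1 + Real.log N) := by
  obtain ⟨M, rfl⟩ := Nat.exists_eq_succ_of_ne_zero hN
  rw [Finset.sum_range_succ']
  have h0 := norm_boxDFT_le (M + 1) l 0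
  have hH : ∑ a ∈ Finset.range M, (1 : ℝ) / ((a + 1 : ℕ) : ℝ) ≤ 1 + Real.log (M + 1 : ℕ) := by
    have h1 := harmonic_le_one_add_log (M + 1)
    rw [harmonic, Finset.sum_range_succ] at h1
    push_cast at h1 ⊢
    have : (0 : ℝ) ≤ ((M : ℝ) + 1)⁻¹ := by positivity
    simp only [one_div]
    linarith
  have h1 : ∑ a ∈ Finset.range M, ‖boxDFT (M + 1) l (a + 1)‖ ≤
      ((M + 1 : ℕ) : ℝ) * (1 + Real.log (M + 1 : ℕ)) := by
    calc ∑ a ∈ Finset.range M, ‖boxDFT (M + 1) l (a + 1)‖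
        ≤ ∑ a ∈ Finset.range M, ((M + 1 : ℕ) : ℝ) / 2 *
            (1 / ((a + 1 : ℕ) : ℝ) + 1 / ((M + 1 - (a + 1) : ℕ) : ℝ)) := by
          refine Finset.sum_le_sum fun a ha => norm_boxDFT_le_inv (Nat.succ_pos _) ?_
          have := Finset.mem_range.1 ha
          omega
      _ = ((M + 1 : ℕ) : ℝ) * ∑ a ∈ Finset.range M, (1 : ℝ) / ((a + 1 : ℕ) : ℝ) := by
          rw [← Finset.mul_sum, Finset.sum_add_distrib]
          have : ∑ a ∈ Finset.range M, (1 : ℝ) / ((M + 1 - (a + 1) : ℕ) : ℝ) =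
              ∑ a ∈ Finset.range M, (1 : ℝ) / ((a + 1 : ℕ) : ℝ) := by
            rw [← Finset.sum_range_reflect]
            refine Finset.sum_congr rfl fun a ha => ?_
            have := Finset.mem_range.1 ha
            congr 2
            omega
          rw [this]
          ring
      _ ≤ _ := by gcongr
  linarith

/-- The sum is the N-periodic extension of the indicator of [0, l). The range of d makes |d - τ| < N
for 0 ≤ τ < l, so no periodic copy interferes. -/
theorem box_eq_sum {N l : ℕ} (hN : N ≠ 0) {d : ℤ} (h1 : -((N : ℤ) - l) ≤ d) (h2 : d < N) :
    (if 0 ≤ d ∧ d < l then (1 : ℂ) else 0) =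
      (N : ℂ)⁻¹ * ∑ a ∈ Finset.range N, boxDFT N l a * expMode N a d := by
  have hN' : (N : ℂ) ≠ 0 := by exact_mod_cast hN
  have h3 : ∑ a ∈ Finset.range N, boxDFT N l a * expMode N a d =
      ∑ τ ∈ Finset.range l, ∑ a ∈ Finset.range N, expMode N a (d - τ) := by
    rw [Finset.sum_comm]
    refine Finset.sum_congr rfl fun a _ => ?_
    rw [boxDFT, Finset.sum_mul]
    refine Finset.sum_congr rfl fun τ _ => ?_
    rw [← expMode_add]
    congr 1
    ring
  have h4 : ∀ τ ∈ Finset.range l, ∑ a ∈ Finset.range N, expMode N a (d - τ) =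
      if d = τ then (N : ℂ) else 0 := by
    intro τ hτ
    rw [sum_expMode hN]
    have hτ' := Finset.mem_range.1 hτ
    congr 1
    refine propext ⟨fun hd => ?_, fun hd => by rw [hd, sub_self]; exact dvd_zero _⟩
    have := Int.eq_zero_of_abs_lt_dvd hd (by rw [abs_lt]; constructor <;> omega)
    omega
  rw [h3, Finset.sum_congr rfl h4]
  split_ifs with h
  · obtain ⟨k, rfl⟩ := Int.eq_ofNat_of_zero_le h.1
    have : ∀ τ : ℕ, ((k : ℤ) = τ) = (k = τ) := fun τ => by simp
    simp_rw [this]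
    rw [Finset.sum_ite_eq, if_pos (Finset.mem_range.2 (by exact_mod_cast h.2)), inv_mul_cancel₀ hN']
  · rw [Finset.sum_eq_zero, mul_zero]
    intro τ hτ
    have := Finset.mem_range.1 hτ
    rw [if_neg]
    intro hd
    exact h ⟨by omega, by omega⟩

/-- A sesquilinear form whose kernel is the indicator of a band is a combination of products of
Fourier coefficients; the coefficients are values of the Dirichlet kernel. -/
theorem norm_band_form_le {N l : ℕ} (hN : N ≠ 0) {I J : Finset ℤ} (d₀ : ℤ)
    (h : ∀ t ∈ I, ∀ s ∈ J, -((N : ℤ) - l) ≤ t - s - d₀ ∧ t - s - d₀ < N) (u v : Signal) :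
    ‖∑ t ∈ I, ∑ s ∈ J, (starRingEnd ℂ) (u t) * v s *
        (if 0 ≤ t - s - d₀ ∧ t - s - d₀ < l then 1 else 0)‖ ≤
      ∑ a ∈ Finset.range N,
        ‖boxDFT N l a‖ * ((‖partialDFT N I u a‖ ^ 2 + ‖partialDFT N J v a‖ ^ 2) / 2) := by
  have hN0 : (0 : ℝ) < N := by positivity
  have hs : (((√(N : ℝ))⁻¹ : ℝ) : ℂ) * (((√(N : ℝ))⁻¹ : ℝ) : ℂ) = (N : ℂ)⁻¹ := by
    rw [← Complex.ofReal_mul, ← mul_inv, Real.mul_self_sqrt hN0.le]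
    push_cast
    rfl
  have key : ∑ t ∈ I, ∑ s ∈ J, (starRingEnd ℂ) (u t) * v s *
        (if 0 ≤ t - s - d₀ ∧ t - s - d₀ < l then 1 else 0) =
      ∑ a ∈ Finset.range N, boxDFT N l a * expMode N a (-d₀) *
        ((starRingEnd ℂ) (partialDFT N I u a) * partialDFT N J v a) := by
    have h1 : ∀ a, boxDFT N l a * expMode N a (-d₀) *
        ((starRingEnd ℂ) (partialDFT N I u a) * partialDFT N J v a) =
        ∑ t ∈ I, ∑ s ∈ J, (starRingEnd ℂ) (u t) * v s *
          ((N : ℂ)⁻¹ * (boxDFT N l a * expMode N a (t - s - d₀))) := by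
      intro a
      rw [partialDFT, partialDFT, map_mul, Complex.conj_ofReal, map_sum,
        mul_mul_mul_comm (((√(N : ℝ))⁻¹ : ℝ) : ℂ), hs,
        Finset.sum_mul_sum, Finset.mul_sum, Finset.mul_sum]
      refine Finset.sum_congr rfl fun t _ => ?_
      rw [Finset.mul_sum, Finset.mul_sum]
      refine Finset.sum_congr rfl fun s _ => ?_
      rw [map_mul, conj_expMode, neg_neg, sub_eq_add_neg, sub_eq_add_neg, expMode_add, expMode_add]
      ring
    simp_rw [h1]
    conv_rhs => rw [Finset.sum_comm]
    refine Finset.sum_congr rfl fun t ht => ?_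
    conv_rhs => rw [Finset.sum_comm]
    refine Finset.sum_congr rfl fun s hs => ?_
    rw [box_eq_sum hN (h t ht s hs).1 (h t ht s hs).2, ← Finset.mul_sum, ← Finset.mul_sum]
  rw [key]
  refine (norm_sum_le _ _).trans (Finset.sum_le_sum fun a _ => ?_)
  rw [norm_mul, norm_mul, norm_expMode, mul_one, norm_mul, RCLike.norm_conj]
  gcongr
  nlinarith [sq_nonneg (‖partialDFT N I u a‖ - ‖partialDFT N J v a‖)]

end Fourier

/-! ### Tail of the moving-average form of a Gaussian vector. -/

section ToeplitzForms

variable {ι : Type*} [Fintype ι]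

theorem partialDFT_add (N : ℕ) (I : Finset ℤ) (u v : Signal) (a : ℕ) :
    partialDFT N I (u + v) a = partialDFT N I u a + partialDFT N I v a := by
  simp only [partialDFT, Pi.add_apply, mul_add, Finset.sum_add_distrib]

theorem partialDFT_smul (N : ℕ) (I : Finset ℤ) (c : ℂ) (u : Signal) (a : ℕ) :
    partialDFT N I (c • u) a = c * partialDFT N I u a := by
  simp only [partialDFT, Pi.smul_apply, smul_eq_mul, Finset.mul_sum]
  exact Finset.sum_congr rfl fun t _ => by ring

/-- The Fourier coefficients of a linear image of a vector. -/
def dftCLM (N : ℕ) (I : Finset ℤ) (T : EuclideanSpace ℂ ι →ₗ[ℂ] Signal) :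
    EuclideanSpace ℂ ι →L[ℂ] EuclideanSpace ℂ (Fin N) :=
  LinearMap.toContinuousLinearMap
    { toFun := fun z => WithLp.toLp 2 fun a : Fin N => partialDFT N I (T z) a
      map_add' := fun z w => by ext a; simp [partialDFT_add]
      map_smul' := fun c z => by ext a; simp [partialDFT_smul] }

theorem dftCLM_apply (N : ℕ) (I : Finset ℤ) (T : EuclideanSpace ℂ ι →ₗ[ℂ] Signal)
    (z : EuclideanSpace ℂ ι) (a : Fin N) : dftCLM N I T z a = partialDFT N I (T z) a := rfl

theorem norm_dftCLM_le {N : ℕ} (hN : N ≠ 0) {I : Finset ℤ}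
    (hI : ∀ t ∈ I, ∀ t' ∈ I, (N : ℤ) ∣ t - t' → t = t') {T : EuclideanSpace ℂ ι →ₗ[ℂ] Signal}
    (hT : ∀ z, ∑ t ∈ I, ‖T z t‖ ^ 2 ≤ ‖z‖ ^ 2) (z : EuclideanSpace ℂ ι) :
    ‖dftCLM N I T z‖ ≤ ‖z‖ := by
  refine le_of_sq_le_sq ?_ (norm_nonneg _)
  rw [EuclideanSpace.norm_sq_eq]
  simp only [dftCLM_apply]
  rw [Fin.sum_univ_eq_sum_range (fun a => ‖partialDFT N I (T z) a‖ ^ 2),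
    sum_norm_partialDFT_sq hN hI]
  exact hT z

theorem lintegral_exp_band_form_le {N l : ℕ} (hN : N ≠ 0) {I J : Finset ℤ} (d₀ : ℤ)
    (h : ∀ t ∈ I, ∀ s ∈ J, -((N : ℤ) - l) ≤ t - s - d₀ ∧ t - s - d₀ < N)
    (hI : ∀ t ∈ I, ∀ t' ∈ I, t - t' < N) (hJ : ∀ t ∈ J, ∀ t' ∈ J, t - t' < N)
    {T U : EuclideanSpace ℂ ι →ₗ[ℂ] Signal}
    (hT : ∀ z, ∑ t ∈ I, ‖T z t‖ ^ 2 ≤ ‖z‖ ^ 2) (hU : ∀ z, ∑ t ∈ J, ‖U z t‖ ^ 2 ≤ ‖z‖ ^ 2)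
    {M x K : ℝ} (hM : 0 < M) (hx : 0 ≤ x) (hxl : x * (l / M) ≤ 1 / 4)
    (hK : 4 * x * ((l + N * (1 + Real.log N)) / M) ≤ K) :
    ∫⁻ z, ENNReal.ofReal (Real.exp (x * (‖∑ t ∈ I, ∑ s ∈ J, (starRingEnd ℂ) (T z t) * U z s *
        (if 0 ≤ t - s - d₀ ∧ t - s - d₀ < l then 1 else 0)‖ / M))) ∂gaussianVec ι ≤
      ENNReal.ofReal (Real.exp K) := by
  have hinj : ∀ {I : Finset ℤ}, (∀ t ∈ I, ∀ t' ∈ I, t - t' < N) →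
      ∀ t ∈ I, ∀ t' ∈ I, (N : ℤ) ∣ t - t' → t = t' := by
    intro I hI t ht t' ht' hd
    have h1 := hI t ht t' ht'
    have h2 := hI t' ht' t ht
    have := Int.eq_zero_of_abs_lt_dvd hd (by rw [abs_lt]; constructor <;> omega)
    omega
  have hb := sum_norm_boxDFT_le hN l
  refine lintegral_exp_le_of_le_sum (dftCLM N I T) (dftCLM N J U)
    (norm_dftCLM_le hN (hinj hI) hT) (norm_dftCLM_le hN (hinj hJ) hU)
    (c := fun a : Fin N => ‖boxDFT N l a‖ / M) (fun a => by positivity) (fun z => ?_) hx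
    (fun a => ?_) (le_trans ?_ hK)
  · rw [div_le_iff₀ hM]
    refine (norm_band_form_le hN d₀ h (T z) (U z)).trans_eq ?_
    rw [← Fin.sum_univ_eq_sum_range (fun a => ‖boxDFT N l a‖ *
      ((‖partialDFT N I (T z) a‖ ^ 2 + ‖partialDFT N J (U z) a‖ ^ 2) / 2)), Finset.sum_mul]
    refine Finset.sum_congr rfl fun a _ => ?_
    rw [dftCLM_apply, dftCLM_apply]
    field_simp
  · refine le_trans ?_ hxl
    have := norm_boxDFT_le N l a
    gcongr
  · rw [← Finset.sum_div, Fin.sum_univ_eq_sum_range (fun a => ‖boxDFT N l a‖)]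
    gcongr

/-- A normalized sum of the values of a linear image of a vector. -/
def sumCLM (p : ℝ) (I : Finset ℤ) (T : EuclideanSpace ℂ ι →ₗ[ℂ] Signal) :
    EuclideanSpace ℂ ι →L[ℂ] EuclideanSpace ℂ Unit :=
  LinearMap.toContinuousLinearMap
    { toFun := fun z => WithLp.toLp 2 fun _ => (((√p)⁻¹ : ℝ) : ℂ) * ∑ t ∈ I, T z t
      map_add' := fun z w => by ext a; simp [Finset.sum_add_distrib, mul_add]
      map_smul' := fun c z => by ext a; simp [← Finset.mul_sum]; ring }

theorem norm_sumCLM_apply_sq {p : ℝ} (hp : 0 < p) (I : Finset ℤ)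
    (T : EuclideanSpace ℂ ι →ₗ[ℂ] Signal) (z : EuclideanSpace ℂ ι) (a : Unit) :
    ‖sumCLM p I T z a‖ ^ 2 = p⁻¹ * ‖∑ t ∈ I, T z t‖ ^ 2 := by
  change ‖(((√p)⁻¹ : ℝ) : ℂ) * ∑ t ∈ I, T z t‖ ^ 2 = _
  rw [norm_mul, mul_pow, Complex.norm_real, Real.norm_eq_abs, sq_abs, inv_pow, Real.sq_sqrt hp.le]

theorem norm_sumCLM_le {p : ℝ} (hp : 0 < p) {I : Finset ℤ} (hI : (I.card : ℝ) ≤ p)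
    {T : EuclideanSpace ℂ ι →ₗ[ℂ] Signal} (hT : ∀ z, ∑ t ∈ I, ‖T z t‖ ^ 2 ≤ ‖z‖ ^ 2)
    (z : EuclideanSpace ℂ ι) : ‖sumCLM p I T z‖ ≤ ‖z‖ := by
  refine le_of_sq_le_sq ?_ (norm_nonneg _)
  rw [EuclideanSpace.norm_sq_eq]
  simp only [norm_sumCLM_apply_sq hp, Finset.univ_unique, Finset.sum_const, Finset.card_singleton,
    one_smul]
  rw [inv_mul_le_iff₀ hp]
  calc ‖∑ t ∈ I, T z t‖ ^ 2 ≤ (∑ t ∈ I, ‖T z t‖) ^ 2 := by gcongr; exact norm_sum_le _ _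
    _ ≤ I.card * ∑ t ∈ I, ‖T z t‖ ^ 2 := sq_sum_le_card_mul_sum_sq
    _ ≤ p * ‖z‖ ^ 2 := by gcongr; exact hT z

/-- The form is a product of two sums; after division by √p and √r each sum is a contraction of z,
and the arithmetic-geometric mean inequality leaves the single weight √(p/r). -/
theorem lintegral_exp_rank_one_form_le {I J : Finset ℤ} {p r : ℝ} (hp : 0 < p) (hr : 0 < r)
    (hI : (I.card : ℝ) ≤ p) (hJ : (J.card : ℝ) ≤ r) {T U : EuclideanSpace ℂ ι →ₗ[ℂ] Signal}
    (hT : ∀ z, ∑ t ∈ I, ‖T z t‖ ^ 2 ≤ ‖z‖ ^ 2) (hU : ∀ z, ∑ t ∈ J, ‖U z t‖ ^ 2 ≤ ‖z‖ ^ 2)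
    {x K : ℝ} (hx : 0 ≤ x) (hx1 : x * √(p / r) ≤ 1 / 4) (hK : 4 * x * √(p / r) ≤ K) :
    ∫⁻ z, ENNReal.ofReal (Real.exp (x * (‖∑ t ∈ I, ∑ s ∈ J,
        (starRingEnd ℂ) (T z t) * U z s‖ / r))) ∂gaussianVec ι ≤
      ENNReal.ofReal (Real.exp K) := by
  refine lintegral_exp_le_of_le_sum (sumCLM p I T) (sumCLM r J U)
    (norm_sumCLM_le hp hI hT) (norm_sumCLM_le hr hJ hU) (c := fun _ : Unit => √(p / r))
    (fun _ => by positivity) (fun z => ?_) hx (fun _ => hx1) (by simpa using hK)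
  rw [← Finset.sum_mul_sum, norm_mul, ← map_sum, RCLike.norm_conj]
  simp only [norm_sumCLM_apply_sq hp, norm_sumCLM_apply_sq hr, Finset.univ_unique,
    Finset.sum_const, Finset.card_singleton, one_smul]
  set a := ‖∑ t ∈ I, T z t‖
  set b := ‖∑ t ∈ J, U z t‖
  have hp' : √p ^ 2 = p := Real.sq_sqrt hp.le
  have hr' : √r ^ 2 = r := Real.sq_sqrt hr.le
  have h1 : 0 < √p := Real.sqrt_pos.2 hp
  have h2 : 0 < √r := Real.sqrt_pos.2 hr
  rw [Real.sqrt_div hp.le]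
  -- The defect in the arithmetic-geometric mean inequality is a square.
  have e : √p / √r * ((p⁻¹ * a ^ 2 + r⁻¹ * b ^ 2) / 2) - a * b / r =
      √p / √r * (a / √p - b / √r) ^ 2 / 2 := by
    rw [← hp', ← hr']
    simp only [Real.sqrt_sq h1.le, Real.sqrt_sq h2.le]
    field_simp
    ring
  have : 0 ≤ √p / √r * (a / √p - b / √r) ^ 2 / 2 := by positivity
  linarith

/-- The bilinear form of the moving average of length `m + 1`. -/
def averageForm (m n : ℕ) (u v : Signal) : ℝ :=
  ‖∑ t ∈ Finset.Icc (0 : ℤ) n, ∑ s ∈ Finset.Icc (-(m : ℤ)) n, (starRingEnd ℂ) (u t) * v s *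
    (if 0 ≤ t - s ∧ t - s < (m + 1 : ℕ) then 1 else 0)‖ / ((m : ℝ) + 1)

theorem measurable_norm_sum_conj_mul (T U : EuclideanSpace ℂ ι →ₗ[ℂ] Signal) (I J : Finset ℤ)
    (c : ℤ → ℤ → ℂ) (M : ℝ) : Measurable fun z : EuclideanSpace ℂ ι =>
      ‖∑ t ∈ I, ∑ s ∈ J, (starRingEnd ℂ) (T z t) * U z s * c t s‖ / M := by
  have h : ∀ (T : EuclideanSpace ℂ ι →ₗ[ℂ] Signal) (t : ℤ), Continuous fun z => T z t := fun T t =>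
    LinearMap.continuous_of_finiteDimensional ((LinearMap.proj t).comp T)
  refine Continuous.measurable ?_
  have h1 := h T
  have h2 := h U
  refine (continuous_norm.comp (continuous_finsetSum _ fun t _ => continuous_finsetSum _
    fun s _ => ?_)).div_const M
  exact ((Complex.continuous_conj.comp (h1 t)).mul (h2 s)).mul continuous_const

theorem three_le_log_fiftyfive : (3 : ℝ) ≤ Real.log 55 := by
  rw [Real.le_log_iff_exp_le (by norm_num)]
  have h : Real.exp 3 = Real.exp 1 ^ 3 := by rw [← Real.exp_nat_mul]; norm_num
  rw [h]
  calc Real.exp 1 ^ 3 ≤ 2.7182818286 ^ 3 := by gcongr; exact Real.exp_one_lt_d9.le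
    _ ≤ 55 := by norm_num

theorem sum_subset_norm_sq_le {T : EuclideanSpace ℂ ι →ₗ[ℂ] Signal} {J J' : Finset ℤ}
    (hJ : J' ⊆ J) (hT : ∀ z, ∑ t ∈ J, ‖T z t‖ ^ 2 ≤ ‖z‖ ^ 2) (z : EuclideanSpace ℂ ι) :
    ∑ t ∈ J', ‖T z t‖ ^ 2 ≤ ‖z‖ ^ 2 :=
  (Finset.sum_le_sum_of_subset_of_nonneg hJ fun _ _ _ => by positivity).trans (hT z)

/-- The factor 1/(m + 1) on the right prepares a union bound over the m + 1 frequencies. -/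
theorem gaussianVec_averageForm_gt_le (m n : ℕ) {T U : EuclideanSpace ℂ ι →ₗ[ℂ] Signal}
    (hT : ∀ z, ∑ t ∈ Finset.Icc (0 : ℤ) n, ‖T z t‖ ^ 2 ≤ ‖z‖ ^ 2)
    (hU : ∀ z, ∑ t ∈ Finset.Icc (-(m : ℤ)) n, ‖U z t‖ ^ 2 ≤ ‖z‖ ^ 2) {α : ℝ} (hα : 0 < α)
    (hα1 : α ≤ 1) :
    gaussianVec ι {z | 2 * (1 + 4 * √(((n : ℝ) + 1) / ((m : ℝ) + 1))) ^ 2 *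
        Real.log (55 * ((m : ℝ) + (n : ℝ) + 1) / α) < averageForm m n (T z) (U z)} ≤
      ENNReal.ofReal (3 / 4 * α / ((m : ℝ) + 1)) := by
  set q : ℝ := √(((n : ℝ) + 1) / ((m : ℝ) + 1)) with hq
  set Λ : ℝ := Real.log (55 * ((m : ℝ) + (n : ℝ) + 1) / α) with hΛ
  have hm0 : (0 : ℝ) < (m : ℝ) + 1 := by positivity
  have hq2 : q ^ 2 = ((n : ℝ) + 1) / ((m : ℝ) + 1) := Real.sq_sqrt (by positivity)
  have hq0 : 0 < q := Real.sqrt_pos.2 (by positivity)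
  have hNpos : (0 : ℝ) < (m : ℝ) + (n : ℝ) + 1 := by positivity
  have hlogN : 0 ≤ Real.log ((m : ℝ) + (n : ℝ) + 1) := Real.log_nonneg (by
    have : (0 : ℝ) ≤ m := by positivity
    have : (0 : ℝ) ≤ n := by positivity
    linarith)
  -- The slack Λ ≥ ln(m + n + 1) + 3 absorbs the additive constants in the trace bounds below.
  have hΛN : Real.log ((m : ℝ) + (n : ℝ) + 1) + 3 ≤ Λ := by
    rw [hΛ, Real.log_div (by positivity) hα.ne', Real.log_mul (by norm_num) hNpos.ne']
    linarith [three_le_log_fiftyfive, Real.log_nonpos hα.le hα1]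
  have hΛα : -Λ ≤ Real.log (3 / 4 * α / ((m : ℝ) + 1)) := by
    rw [hΛ, ← Real.log_inv]
    refine Real.log_le_log (by positivity) ?_
    rw [inv_div, div_le_div_iff₀ (by positivity) hm0]
    have : (0 : ℝ) ≤ n := by positivity
    nlinarith
  -- it suffices to bound an exponential moment
  have main : ∀ x K : ℝ, 0 ≤ x → K + Λ ≤ x * (2 * (1 + 4 * q) ^ 2 * Λ) →
      ∫⁻ z, ENNReal.ofReal (Real.exp (x * averageForm m n (T z) (U z))) ∂gaussianVec ι ≤
        ENNReal.ofReal (Real.exp K) →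
      gaussianVec ι {z | 2 * (1 + 4 * q) ^ 2 * Λ < averageForm m n (T z) (U z)} ≤
        ENNReal.ofReal (3 / 4 * α / ((m : ℝ) + 1)) := by
    intro x K hx hK h
    refine (measure_gt_le_of_lintegral_exp_le (measurable_norm_sum_conj_mul T U _ _ _ _) hx h).trans
      (ENNReal.ofReal_le_ofReal ?_)
    rw [← Real.le_log_iff_exp_le (by positivity)]
    linarith
  -- If m < n, one circulant of order m + n + 1 covers the whole kernel. If n ≤ m, that order would
  -- be wasteful: the bulk of the kernel is constant and is treated as a form of rank one.
  rcases lt_or_ge m n with hmn | hmn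
  · have hq1 : 1 ≤ q := by
      rw [hq, Real.one_le_sqrt, one_le_div hm0]
      have : (m : ℝ) ≤ n := by exact_mod_cast hmn.le
      linarith
    have hN : ((m + n + 1 : ℕ) : ℝ) = (m : ℝ) + (n : ℝ) + 1 := by push_cast; ring
    have hratio : ((m : ℝ) + (n : ℝ) + 1) / ((m : ℝ) + 1) ≤ 1 + q ^ 2 := by
      rw [hq2, div_le_iff₀ hm0]
      field_simp
      linarith
    -- The band length divided by m + 1 is one, so 1/4 is the largest exponent that the moment bound
    -- admits.
    refine main (1 / 4) ((1 + q ^ 2) * Λ) (by norm_num) ?_ ?_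
    · nlinarith
    · have key := lintegral_exp_band_form_le (N := m + n + 1) (l := m + 1) (Nat.succ_ne_zero _)
        (I := Finset.Icc (0 : ℤ) n) (J := Finset.Icc (-(m : ℤ)) n) 0
        (by intro t ht s hs; rw [Finset.mem_Icc] at ht hs; push_cast; constructor <;> omega)
        (by intro t ht s hs; rw [Finset.mem_Icc] at ht hs; push_cast; omega)
        (by intro t ht s hs; rw [Finset.mem_Icc] at ht hs; push_cast; omega)
        hT hU (M := (m : ℝ) + 1) (x := 1 / 4) (K := (1 + q ^ 2) * Λ) hm0 (by norm_num)
        (by push_cast; rw [div_self hm0.ne']; norm_num)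
        (by
          rw [hN]
          push_cast
          rw [add_div, div_self hm0.ne', mul_div_right_comm]
          have : ((m : ℝ) + (n : ℝ) + 1) / ((m : ℝ) + 1) *
              (1 + Real.log ((m : ℝ) + (n : ℝ) + 1)) ≤ (1 + q ^ 2) * (Λ - 2) := by
            gcongr
            linarith
          nlinarith)
      simp only [sub_zero] at key
      exact key
  -- Jensen's inequality for three terms triples the exponent, and 3xq = 1/4 is the limit for the
  -- rank one piece.
  · set x : ℝ := 1 / (12 * q) with hx
    have hx0 : 0 ≤ x := by positivity
    have hxq : x * q = 1 / 12 := by rw [hx]; field_simp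
    have hq1 : q ≤ 1 := by
      rw [hq, Real.sqrt_le_left zero_le_one, one_pow, div_le_one hm0]
      have : (n : ℝ) ≤ m := by exact_mod_cast hmn
      linarith
    -- A common bound for the sums of weights: q serves the rank one piece, and the multiple of q²
    -- serves each triangular piece.
    set W : ℝ := q + q ^ 2 * (3 + 2 * Real.log ((m : ℝ) + (n : ℝ) + 1)) with hW
    -- The kernel is cut along s. For n - m ≤ s ≤ 0 every t in [0, n] satisfies 0 ≤ t - s ≤ m, so
    -- the indicator is one; this is Y. The two ends X and Z are triangles with at most n values of
    -- s. After a shift by m - n for X, they are bands of length n + 1 that fit a transform of order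
    -- 2n + 1.
    set X : (EuclideanSpace ℂ ι) → ℝ := fun z => ‖∑ t ∈ Finset.Icc (0 : ℤ) n,
      ∑ s ∈ Finset.Icc (-(m : ℤ)) (n - m - 1), (starRingEnd ℂ) (T z t) * U z s *
        (if 0 ≤ t - s - ((m : ℤ) - n) ∧ t - s - ((m : ℤ) - n) < (n + 1 : ℕ) then 1 else 0)‖ /
        ((m : ℝ) + 1) with hX
    set Y : (EuclideanSpace ℂ ι) → ℝ := fun z => ‖∑ t ∈ Finset.Icc (0 : ℤ) n,
      ∑ s ∈ Finset.Icc ((n : ℤ) - m) 0, (starRingEnd ℂ) (T z t) * U z s‖ / ((m : ℝ) + 1) with hY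
    set Z : (EuclideanSpace ℂ ι) → ℝ := fun z => ‖∑ t ∈ Finset.Icc (0 : ℤ) n,
      ∑ s ∈ Finset.Icc (1 : ℤ) n, (starRingEnd ℂ) (T z t) * U z s *
        (if 0 ≤ t - s - 0 ∧ t - s - 0 < (n + 1 : ℕ) then 1 else 0)‖ / ((m : ℝ) + 1) with hZ
    have hXm : Measurable X := measurable_norm_sum_conj_mul T U _ _ _ _
    have hYm : Measurable Y := by
      have := measurable_norm_sum_conj_mul T U (Finset.Icc (0 : ℤ) n)
        (Finset.Icc ((n : ℤ) - m) 0) (fun _ _ => 1) ((m : ℝ) + 1)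
      simpa only [mul_one] using this
    have hZm : Measurable Z := measurable_norm_sum_conj_mul T U _ _ _ _
    have hle : ∀ z, averageForm m n (T z) (U z) ≤ X z + Y z + Z z := by
      intro z
      rw [hX, hY, hZ, averageForm]
      simp only
      rw [← add_div, ← add_div]
      gcongr
      refine le_trans (le_of_eq ?_) ((norm_add_le _ _).trans
        (add_le_add (norm_add_le _ _) le_rfl))
      congr 1
      rw [← Finset.sum_add_distrib, ← Finset.sum_add_distrib]
      refine Finset.sum_congr rfl fun t ht => ?_
      rw [Finset.mem_Icc] at ht
      have hsplit : Finset.Icc (-(m : ℤ)) n = (Finset.Icc (-(m : ℤ)) (n - m - 1) ∪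
          Finset.Icc ((n : ℤ) - m) 0) ∪ Finset.Icc (1 : ℤ) n := by
        ext s
        simp only [Finset.mem_union, Finset.mem_Icc]
        omega
      rw [hsplit, Finset.sum_union, Finset.sum_union]
      · congr 1
        · congr 1
          · refine Finset.sum_congr rfl fun s hs => ?_
            rw [Finset.mem_Icc] at hs
            congr 1
            refine if_congr ?_ rfl rfl
            push_cast
            omega
          · refine Finset.sum_congr rfl fun s hs => ?_
            rw [Finset.mem_Icc] at hs
            rw [if_pos, mul_one]
            push_cast
            omega
        · refine Finset.sum_congr rfl fun s hs => ?_
          rw [Finset.mem_Icc] at hs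
          congr 1
          refine if_congr ?_ rfl rfl
          push_cast
          omega
      · rw [Finset.disjoint_left]
        intro s hs hs'
        rw [Finset.mem_Icc] at hs hs'
        omega
      · rw [Finset.disjoint_left]
        intro s hs hs'
        rw [Finset.mem_union, Finset.mem_Icc, Finset.mem_Icc] at hs
        rw [Finset.mem_Icc] at hs'
        omega
    have hN : ((2 * n + 1 : ℕ) : ℝ) = 2 * n + 1 := by push_cast; ring
    have hlog : Real.log (2 * n + 1 : ℝ) ≤ Real.log ((m : ℝ) + (n : ℝ) + 1) := by
      refine Real.log_le_log (by positivity) ?_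
      have : (n : ℝ) ≤ m := by exact_mod_cast hmn
      linarith
    have hl1 : 3 * x * (((n + 1 : ℕ) : ℝ) / ((m : ℝ) + 1)) ≤ 1 / 4 := by
      push_cast
      rw [← hq2]
      nlinarith
    have hl2 : 4 * (3 * x) * ((((n + 1 : ℕ) : ℝ) + ((2 * n + 1 : ℕ) : ℝ) *
        (1 + Real.log ((2 * n + 1 : ℕ) : ℝ))) / ((m : ℝ) + 1)) ≤ 12 * x * W := by
      have h1 : (((n + 1 : ℕ) : ℝ) + ((2 * n + 1 : ℕ) : ℝ) *
          (1 + Real.log ((2 * n + 1 : ℕ) : ℝ))) / ((m : ℝ) + 1) ≤ W := by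
        have h2 : (((n + 1 : ℕ) : ℝ) + ((2 * n + 1 : ℕ) : ℝ) *
            (1 + Real.log ((2 * n + 1 : ℕ) : ℝ))) ≤
            ((n : ℝ) + 1) * (3 + 2 * Real.log ((m : ℝ) + (n : ℝ) + 1)) := by
          rw [hN]
          push_cast
          have : (2 * (n : ℝ) + 1) * (1 + Real.log (2 * n + 1 : ℝ)) ≤
              (2 * ((n : ℝ) + 1)) * (1 + Real.log ((m : ℝ) + (n : ℝ) + 1)) := by
            have h0 : 0 ≤ Real.log (2 * n + 1 : ℝ) := Real.log_nonneg (by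
              have : (0 : ℝ) ≤ n := by positivity
              linarith)
            exact mul_le_mul (by linarith) (by linarith) (by linarith) (by positivity)
          linarith
        calc _ ≤ ((n : ℝ) + 1) * (3 + 2 * Real.log ((m : ℝ) + (n : ℝ) + 1)) / ((m : ℝ) + 1) := by
              gcongr
          _ = q ^ 2 * (3 + 2 * Real.log ((m : ℝ) + (n : ℝ) + 1)) := by rw [hq2]; ring
          _ ≤ W := by rw [hW]; linarith
      calc _ ≤ 4 * (3 * x) * W := by gcongr
        _ = 12 * x * W := by ring
    refine main x (12 * x * W) hx0 ?_ ?_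
    · have h1 : 12 * q * (12 * x * W + Λ) ≤ 12 * q * (x * (2 * (1 + 4 * q) ^ 2 * Λ)) := by
        have e1 : 12 * q * (12 * x * W + Λ) = 12 * W + 12 * q * Λ := by
          linear_combination (144 * W) * hxq
        have e2 : 12 * q * (x * (2 * (1 + 4 * q) ^ 2 * Λ)) = 2 * (1 + 4 * q) ^ 2 * Λ := by
          linear_combination (24 * (1 + 4 * q) ^ 2 * Λ) * hxq
        rw [e1, e2, hW]
        have h3 : q ^ 2 * (3 + 2 * Real.log ((m : ℝ) + (n : ℝ) + 1)) ≤ q ^ 2 * (2 * Λ) := by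
          gcongr
          linarith
        have h4 : 0 ≤ q * (Λ - 3) := mul_nonneg hq0.le (by linarith)
        have h5 : 0 ≤ q ^ 2 * Λ := by
          have : 0 ≤ Λ := by linarith
          positivity
        nlinarith
      exact le_of_mul_le_mul_left h1 (by positivity)
    · have hcard : ((Finset.Icc ((n : ℤ) - m) 0).card : ℝ) ≤ (m : ℝ) + 1 := by
        rw [Int.card_Icc]
        have : (0 + 1 - ((n : ℤ) - m)).toNat ≤ m + 1 := by omega
        exact_mod_cast this
      have b1 := lintegral_exp_band_form_le (N := 2 * n + 1) (l := n + 1) (Nat.succ_ne_zero _)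
        (I := Finset.Icc (0 : ℤ) n) (J := Finset.Icc (-(m : ℤ)) (n - m - 1)) ((m : ℤ) - n)
        (by intro t ht s hs; rw [Finset.mem_Icc] at ht hs; push_cast; constructor <;> omega)
        (by intro t ht s hs; rw [Finset.mem_Icc] at ht hs; push_cast; omega)
        (by intro t ht s hs; rw [Finset.mem_Icc] at ht hs; push_cast; omega)
        hT (sum_subset_norm_sq_le (Finset.Icc_subset_Icc le_rfl (by omega)) hU)
        hm0 (by positivity) hl1 hl2
      have b2 := lintegral_exp_rank_one_form_le (ι := ι) (I := Finset.Icc (0 : ℤ) n)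
        (J := Finset.Icc ((n : ℤ) - m) 0) (p := (n : ℝ) + 1) (r := (m : ℝ) + 1) (by positivity) hm0
        (by rw [Int.card_Icc]; norm_num) hcard hT
        (sum_subset_norm_sq_le (Finset.Icc_subset_Icc (by omega) (by omega)) hU)
        (x := 3 * x) (K := 12 * x * W) (by positivity) (by rw [← hq]; linarith)
        (by
          rw [← hq, hW]
          have : 0 ≤ x * (q ^ 2 * (3 + 2 * Real.log ((m : ℝ) + (n : ℝ) + 1))) := by positivity
          linarith)
      have b3 := lintegral_exp_band_form_le (N := 2 * n + 1) (l := n + 1) (Nat.succ_ne_zero _)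
        (I := Finset.Icc (0 : ℤ) n) (J := Finset.Icc (1 : ℤ) n) 0
        (by intro t ht s hs; rw [Finset.mem_Icc] at ht hs; push_cast; constructor <;> omega)
        (by intro t ht s hs; rw [Finset.mem_Icc] at ht hs; push_cast; omega)
        (by intro t ht s hs; rw [Finset.mem_Icc] at ht hs; push_cast; omega)
        hT (sum_subset_norm_sq_le (Finset.Icc_subset_Icc (by omega) le_rfl) hU)
        hm0 (by positivity) hl1 hl2
      refine le_trans (lintegral_mono fun z => ENNReal.ofReal_le_ofReal (Real.exp_le_exp.2
        (mul_le_mul_of_nonneg_left (hle z) hx0))) ?_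
      exact lintegral_exp_add_three_le hXm hYm hZm b1 b2 b3

end ToeplitzForms

/-! ### The deterministic inequality and reduction over feasible filters. -/

section Recovery

theorem shift_pow_apply (τ : ℕ) (v : Signal) (t : ℤ) : (shift ^ τ) v t = v (t - τ) := by
  induction τ generalizing t with
  | zero => simp
  | succ k ih =>
    rw [pow_succ', Module.End.mul_apply]
    change (shift ^ k) v (t - 1) = _
    rw [ih]
    congr 1
    push_cast
    ring

theorem conv_eq_sum {m : ℕ} {φ : Signal} (hφ : IsFilter m φ) (v : Signal) :
    conv φ v = ∑ τ ∈ Finset.range (m + 1), φ τ • (shift ^ τ) v := by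
  ext t
  rw [conv, finsum_eq_sum_of_support_subset (s := (Finset.range (m + 1)).map Nat.castEmbedding),
    Finset.sum_map, Finset.sum_apply]
  · refine Finset.sum_congr rfl fun τ _ => ?_
    rw [Pi.smul_apply, shift_pow_apply, smul_eq_mul]
    rfl
  · intro τ hτ
    have h1 : φ τ ≠ 0 := fun h => hτ (by simp [h])
    have h2 : τ ∈ Set.Icc (0 : ℤ) m := by
      by_contra h
      exact h1 (hφ τ h)
    obtain ⟨k, rfl⟩ := Int.eq_ofNat_of_zero_le h2.1
    have h3 : k ≤ m := by exact_mod_cast h2.2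
    simp only [Finset.coe_map, Set.mem_image, Finset.mem_coe, Finset.mem_range]
    exact ⟨k, by omega, rfl⟩

theorem conv_add {m : ℕ} {φ : Signal} (hφ : IsFilter m φ) (u v : Signal) :
    conv φ (u + v) = conv φ u + conv φ v := by
  simp only [conv_eq_sum hφ, map_add, smul_add, Finset.sum_add_distrib]

theorem conv_smul {m : ℕ} {φ : Signal} (hφ : IsFilter m φ) (c : ℂ) (v : Signal) :
    conv φ (c • v) = c • conv φ v := by
  simp only [conv_eq_sum hφ, map_smul, Finset.smul_sum, smul_comm c]

/-- The restriction of a sequence to `{0, …, n}`. -/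
def restrict (n : ℕ) : Signal →ₗ[ℂ] EuclideanSpace ℂ (Fin (n + 1)) where
  toFun x := WithLp.toLp 2 fun t => x (t : ℕ)
  map_add' _ _ := rfl
  map_smul' _ _ := rfl

theorem restrict_apply (n : ℕ) (x : Signal) (t : Fin (n + 1)) : restrict n x t = x (t : ℕ) := rfl

theorem norm2_eq_norm_restrict (n : ℕ) (x : Signal) : norm2 n x = ‖restrict n x‖ := by
  rw [norm2, EuclideanSpace.norm_eq]
  congr 1
  exact (Fin.sum_univ_eq_sum_range (fun t => ‖x (t : ℕ)‖ ^ 2) (n + 1)).symm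

theorem inner_restrict (n : ℕ) (h : EuclideanSpace ℂ (Fin (n + 1))) (x : Signal) :
    inner ℂ h (restrict n x) = ∑ t : Fin (n + 1), (starRingEnd ℂ) (h t) * x (t : ℕ) := by
  rw [PiLp.inner_apply]
  exact Finset.sum_congr rfl fun t _ => by rw [restrict_apply, RCLike.inner_apply, mul_comm]

theorem restrict_conv_congr {m n : ℕ} {φ : Signal} (hφ : IsFilter m φ) {u v : Signal}
    (h : ∀ t ∈ Set.Icc (-(m : ℤ)) n, u t = v t) :
    restrict n (conv φ u) = restrict n (conv φ v) := by
  ext t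
  rw [restrict_apply, restrict_apply, conv_eq_sum hφ, conv_eq_sum hφ, Finset.sum_apply,
    Finset.sum_apply]
  refine Finset.sum_congr rfl fun τ hτ => ?_
  have h1 := Finset.mem_range.1 hτ
  have h2 := t.2
  rw [Pi.smul_apply, Pi.smul_apply, shift_pow_apply, shift_pow_apply, h]
  constructor <;> omega

/-- Otherwise a - b - c and a + b both exceed √d, whereas their product a² - b² - c(a + b) is at
most d. -/
theorem le_add_sqrt_of_sq_le {a b c d : ℝ} (hb : 0 ≤ b) (hc : 0 ≤ c) (hd : 0 ≤ d)
    (h : a ^ 2 ≤ b ^ 2 + c * (a + b) + d) : a ≤ b + c + √d := by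
  by_contra! hlt
  have h1 : √d ^ 2 = d := Real.sq_sqrt hd
  have h2 : 0 ≤ √d := Real.sqrt_nonneg d
  have h3 : √d * √d < (a - b - c) * (a + b) := by
    have h4 : √d < a - b - c := by linarith
    have h5 : √d ≤ a + b := by linarith
    have h6 : 0 < a + b := by linarith
    nlinarith
  nlinarith

/-- The basic inequality for the constrained least squares recovery: the correlation of the noise
`w` with the residual is split along a subspace that contains the shifts of `u`. -/
theorem norm2_recovery_le {m n : ℕ} {ρ σ : ℝ} (hσ : 0 ≤ σ) {u ε w φ φo : Signal}
    (U : Submodule ℂ (EuclideanSpace ℂ (Fin (n + 1))))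
    (hU : ∀ τ : ℕ, restrict n ((shift ^ τ) u) ∈ U)
    (hφ : IsConstrainedRecoveryFilter m n ρ (u + ε + (σ : ℂ) • w) φ) (hφo : IsFeasible m ρ φo)
    {T b₁ b₂ : ℝ} (hT : ‖U.starProjection (restrict n w)‖ ≤ T)
    (h₁ : ∀ ψ, IsFeasible m ρ ψ →
      ‖inner ℂ (Uᗮ.starProjection (restrict n w)) (restrict n (conv ψ ε))‖ ≤ b₁)
    (h₂ : ∀ ψ, IsFeasible m ρ ψ →
      ‖inner ℂ (Uᗮ.starProjection (restrict n w)) (restrict n (conv ψ w))‖ ≤ b₂) :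
    norm2 n (u + ε - conv φ (u + ε + (σ : ℂ) • w)) ≤
      norm2 n (u + ε - conv φo (u + ε + (σ : ℂ) • w)) + 2 * σ * T + √(4 * σ * (b₁ + σ * b₂)) := by
  set x := u + ε with hx
  set y := x + (σ : ℂ) • w with hy
  set ξ := restrict n w with hξ
  set P := U.starProjection ξ with hP
  set Q := Uᗮ.starProjection ξ with hQ
  set a := restrict n (x - conv φ y) with ha
  set b := restrict n (x - conv φo y) with hb
  have hPQ : ξ = P + Q := (U.starProjection_add_starProjection_orthogonal ξ).symm
  have hT0 : 0 ≤ T := (norm_nonneg _).trans hT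
  have hb₁ : 0 ≤ b₁ := (norm_nonneg _).trans (h₁ φo hφo)
  have hb₂ : 0 ≤ b₂ := (norm_nonneg _).trans (h₂ φo hφo)
  -- The filtered u lies in U, so Q annihilates it; only ε and the noise survive.
  have hQconv : ∀ ψ, IsFeasible m ρ ψ → ‖inner ℂ Q (restrict n (conv ψ y))‖ ≤ b₁ + σ * b₂ := by
    intro ψ hψ
    have h0 : inner ℂ Q (restrict n (conv ψ u)) = 0 := by
      have : restrict n (conv ψ u) ∈ U := by
        rw [conv_eq_sum hψ.1, map_sum]
        refine U.sum_mem fun τ _ => ?_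
        rw [map_smul]
        exact U.smul_mem _ (hU τ)
      exact Submodule.inner_left_of_mem_orthogonal this (Submodule.starProjection_apply_mem _ _)
    rw [hy, hx, conv_add hψ.1, conv_add hψ.1, conv_smul hψ.1, map_add, map_add, map_smul,
      inner_add_right, inner_add_right, inner_smul_right, h0, zero_add]
    refine (norm_add_le _ _).trans ?_
    rw [norm_mul, Complex.norm_real, Real.norm_of_nonneg hσ]
    exact add_le_add (h₁ ψ hψ) (mul_le_mul_of_nonneg_left (h₂ ψ hψ) hσ)
  have hopt : ‖a + (σ : ℂ) • ξ‖ ≤ ‖b + (σ : ℂ) • ξ‖ := by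
    have h := hφ.2 φo hφo
    rw [norm2_eq_norm_restrict, norm2_eq_norm_restrict] at h
    have e : ∀ ψ : Signal, restrict n (y - conv ψ y) = restrict n (x - conv ψ y) + (σ : ℂ) • ξ := by
      intro ψ
      rw [hξ, ← map_smul, ← map_add]
      congr 1
      rw [hy]
      abel
    rwa [e, e] at h
  have hsq : ‖a‖ ^ 2 ≤ ‖b‖ ^ 2 + 2 * σ * (inner ℂ ξ (b - a)).re := by
    have h := pow_le_pow_left₀ (norm_nonneg _) hopt 2
    rw [@norm_add_sq ℂ, @norm_add_sq ℂ] at h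
    simp only [inner_smul_right, RCLike.re_to_complex, Complex.re_ofReal_mul] at h
    rw [inner_sub_right, Complex.sub_re, ← inner_conj_symm ξ a, ← inner_conj_symm ξ b,
      Complex.conj_re, Complex.conj_re]
    linarith
  have hre : (inner ℂ ξ (b - a)).re ≤ T * (‖a‖ + ‖b‖) + 2 * (b₁ + σ * b₂) := by
    rw [hPQ, inner_add_left, Complex.add_re]
    have e1 : (inner ℂ P (b - a)).re ≤ T * (‖a‖ + ‖b‖) := by
      calc (inner ℂ P (b - a)).re ≤ ‖inner ℂ P (b - a)‖ := Complex.re_le_norm _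
        _ ≤ ‖P‖ * ‖b - a‖ := norm_inner_le_norm _ _
        _ ≤ T * (‖a‖ + ‖b‖) := by
          have : ‖b - a‖ ≤ ‖a‖ + ‖b‖ := (norm_sub_le _ _).trans_eq (add_comm _ _)
          gcongr
    have e2 : (inner ℂ Q (b - a)).re ≤ 2 * (b₁ + σ * b₂) := by
      have : b - a = restrict n (conv φ y) - restrict n (conv φo y) := by
        rw [ha, hb, map_sub, map_sub]
        abel
      rw [this, inner_sub_right]
      refine (Complex.re_le_norm _).trans ((norm_sub_le _ _).trans ?_)
      linarith [hQconv φ hφ.1, hQconv φo hφo]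
    linarith
  rw [norm2_eq_norm_restrict, norm2_eq_norm_restrict]
  refine le_add_sqrt_of_sq_le (norm_nonneg _) (by positivity) (by positivity) ?_
  have := mul_le_mul_of_nonneg_left hre (by positivity : 0 ≤ 2 * σ)
  linarith

theorem sum_Icc_zero_eq_sum_range {M : Type*} [AddCommMonoid M] (n : ℕ) (f : ℤ → M) :
    ∑ t ∈ Finset.Icc (0 : ℤ) n, f t = ∑ t ∈ Finset.range (n + 1), f t := by
  have : Finset.Icc (0 : ℤ) n = (Finset.range (n + 1)).map Nat.castEmbedding := by
    ext t
    simp only [Finset.mem_Icc, Finset.mem_map, Finset.mem_range, Nat.castEmbedding_apply]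
    constructor
    · rintro ⟨h1, h2⟩
      exact ⟨t.toNat, by omega, by omega⟩
    · rintro ⟨k, hk, rfl⟩
      constructor <;> omega
  rw [this, Finset.sum_map]
  rfl

theorem dft_eq (n : ℕ) (z : Signal) (k : ℕ) :
    dft n z k = (((√((n : ℝ) + 1))⁻¹ : ℝ) : ℂ) *
      ∑ t ∈ Finset.range (n + 1), z t * expMode (n + 1) k t := by
  rw [dft]
  congr 1
  refine Finset.sum_congr rfl fun t _ => ?_
  rw [expMode]
  push_cast
  rfl

theorem sum_norm_dft_sq (n : ℕ) (z : Signal) :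
    ∑ k ∈ Finset.range (n + 1), ‖dft n z k‖ ^ 2 = ∑ t ∈ Finset.range (n + 1), ‖z t‖ ^ 2 := by
  have h := sum_norm_partialDFT_sq (Nat.succ_ne_zero n) (I := Finset.Icc (0 : ℤ) n) (by
    intro t ht t' ht' hd
    rw [Finset.mem_Icc] at ht ht'
    have := Int.eq_zero_of_abs_lt_dvd hd (by rw [abs_lt]; push_cast; constructor <;> omega)
    omega) (fun t => (starRingEnd ℂ) (z t))
  rw [sum_Icc_zero_eq_sum_range] at h
  simp only [RCLike.norm_conj] at h
  rw [← h]
  refine Finset.sum_congr rfl fun k _ => ?_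
  congr 1
  rw [← RCLike.norm_conj, dft_eq, partialDFT, sum_Icc_zero_eq_sum_range, map_mul, map_sum,
    Complex.conj_ofReal]
  congr 2
  · push_cast; rfl
  · refine Finset.sum_congr rfl fun t _ => ?_
    rw [map_mul, conj_expMode, mul_comm]

theorem eq_sum_dft (n : ℕ) (z : Signal) {t : ℕ} (ht : t ∈ Finset.range (n + 1)) :
    z t = (((√((n : ℝ) + 1))⁻¹ : ℝ) : ℂ) *
      ∑ k ∈ Finset.range (n + 1), dft n z k * expMode (n + 1) k (-(t : ℤ)) := by
  have hn : (0 : ℝ) < (n : ℝ) + 1 := by positivity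
  have hs : (((√((n : ℝ) + 1))⁻¹ : ℝ) : ℂ) * (((√((n : ℝ) + 1))⁻¹ : ℝ) : ℂ) = ((n : ℂ) + 1)⁻¹ := by
    rw [← Complex.ofReal_mul, ← mul_inv, Real.mul_self_sqrt hn.le]
    push_cast
    rfl
  have hn' : (n : ℂ) + 1 ≠ 0 := by exact_mod_cast hn.ne'
  simp_rw [dft_eq, mul_assoc _ _ (expMode _ _ _)]
  rw [← Finset.mul_sum, ← mul_assoc, hs]
  simp_rw [Finset.sum_mul]
  rw [Finset.sum_comm]
  have h2 : ∀ u ∈ Finset.range (n + 1), ∑ k ∈ Finset.range (n + 1),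
      z u * expMode (n + 1) k u * expMode (n + 1) k (-(t : ℤ)) =
      if t = u then ((n : ℂ) + 1) * z t else 0 := by
    intro u hu
    simp_rw [mul_assoc, ← expMode_add]
    rw [← Finset.mul_sum, sum_expMode (Nat.succ_ne_zero n)]
    rw [Finset.mem_range] at ht hu
    by_cases h : t = u
    · subst h
      rw [if_pos rfl, add_neg_cancel, if_pos (dvd_zero _)]
      push_cast
      ring
    · rw [if_neg h, if_neg, mul_zero]
      intro hd
      have := Int.eq_zero_of_abs_lt_dvd hd (by rw [abs_lt]; push_cast; constructor <;> omega)
      omega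
  rw [Finset.sum_congr rfl h2, Finset.sum_ite_eq, if_pos ht, ← mul_assoc, inv_mul_cancel₀ hn',
    one_mul]

/-- Parseval's identity, and the ℓ² norm is at most the ℓ¹ norm. -/
theorem sum_norm_sq_le_of_isFeasible {m : ℕ} {ρ : ℝ} {ψ : Signal} (hψ : IsFeasible m ρ ψ) :
    ∑ t ∈ Finset.range (m + 1), ‖ψ t‖ ^ 2 ≤ (ρ / √((m : ℝ) + 1)) ^ 2 := by
  rw [← sum_norm_dft_sq]
  calc ∑ k ∈ Finset.range (m + 1), ‖dft m ψ k‖ ^ 2 ≤ (dftNorm1 m ψ) ^ 2 :=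
        Finset.sum_sq_le_sq_sum_of_nonneg fun k _ => norm_nonneg _
    _ ≤ (ρ / √((m : ℝ) + 1)) ^ 2 := by
        have : 0 ≤ dftNorm1 m ψ := Finset.sum_nonneg fun k _ => norm_nonneg _
        gcongr
        exact hψ.2

/-- Cauchy–Schwarz over the shifts τ; the factor m + 1 in the hypothesis cancels the one in the ℓ²
bound for the filter. -/
theorem norm_inner_restrict_conv_le {m n : ℕ} {ρ : ℝ} {ψ : Signal} (hψ : IsFeasible m ρ ψ)
    (h : EuclideanSpace ℂ (Fin (n + 1))) (ε : Signal) {b : ℝ} (hb : 0 ≤ b) (hρ : 0 ≤ ρ)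
    (hε : ∑ τ : Fin (m + 1), ‖inner ℂ h (restrict n ((shift ^ (τ : ℕ)) ε))‖ ^ 2 ≤
      ((m : ℝ) + 1) * b ^ 2) :
    ‖inner ℂ h (restrict n (conv ψ ε))‖ ≤ ρ * b := by
  have hm : (0 : ℝ) < (m : ℝ) + 1 := by positivity
  rw [Fin.sum_univ_eq_sum_range
    (fun τ => ‖inner ℂ h (restrict n ((shift ^ τ) ε))‖ ^ 2)] at hε
  rw [conv_eq_sum hψ.1, map_sum, inner_sum]
  simp_rw [map_smul, inner_smul_right]
  refine (norm_sum_le _ _).trans ?_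
  simp_rw [norm_mul]
  refine le_of_sq_le_sq ?_ (by positivity)
  refine (Finset.sum_mul_sq_le_sq_mul_sq _ _ _).trans ?_
  refine (mul_le_mul (sum_norm_sq_le_of_isFeasible hψ) hε (by positivity) (by positivity)).trans_eq ?_
  rw [div_pow, Real.sq_sqrt hm.le]
  field_simp

/-- Pointwise multiplication by an exponential. -/
def modulate (N k : ℕ) : Signal →ₗ[ℂ] Signal where
  toFun v := fun t => expMode N k t * v t
  map_add' u v := by ext t; simp [mul_add]
  map_smul' c v := by ext t; simp; ring

theorem modulate_apply (N k : ℕ) (v : Signal) (t : ℤ) :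
    modulate N k v t = expMode N k t * v t := rfl

theorem norm_modulate_apply (N k : ℕ) (v : Signal) (t : ℤ) : ‖modulate N k v t‖ = ‖v t‖ := by
  rw [modulate_apply, norm_mul, norm_expMode, one_mul]

/-- The extension by zero of a vector indexed by `{0, …, n}`. -/
def extendFin (n : ℕ) : EuclideanSpace ℂ (Fin (n + 1)) →ₗ[ℂ] Signal where
  toFun h := fun t => if ht : t.toNat < n + 1 ∧ 0 ≤ t then h ⟨t.toNat, ht.1⟩ else 0
  map_add' u v := by ext t; simp only [Pi.add_apply, PiLp.add_apply]; split_ifs <;> simp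
  map_smul' c v := by
    ext t
    simp only [Pi.smul_apply, PiLp.smul_apply, RingHom.id_apply]
    split_ifs <;> simp

theorem extendFin_natCast {n : ℕ} (h : EuclideanSpace ℂ (Fin (n + 1))) (t : Fin (n + 1)) :
    extendFin n h ((t : ℕ) : ℤ) = h t := by
  have ht : ((t : ℕ) : ℤ).toNat < n + 1 ∧ (0 : ℤ) ≤ ((t : ℕ) : ℤ) :=
    ⟨by rw [Int.toNat_natCast]; exact t.2, Int.natCast_nonneg _⟩
  simp only [extendFin, LinearMap.coe_mk, AddHom.coe_mk]
  exact dif_pos ht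

/-- Since conj(e(t)) e(s) = e(-(t - s)), modulating both arguments inserts the character in τ = t -
s. As modulation preserves absolute values, one tail bound serves all frequencies. -/
theorem averageForm_modulate (m n k : ℕ) (h : EuclideanSpace ℂ (Fin (n + 1))) (w : Signal) :
    averageForm m n (modulate (m + 1) k (extendFin n h)) (modulate (m + 1) k w) =
      ‖∑ τ ∈ Finset.range (m + 1), expMode (m + 1) k (-(τ : ℤ)) *
        inner ℂ h (restrict n ((shift ^ τ) w))‖ / ((m : ℝ) + 1) := by
  rw [averageForm]
  congr 2
  have h1 : ∀ t ∈ Finset.Icc (0 : ℤ) n, ∑ s ∈ Finset.Icc (-(m : ℤ)) n,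
      (starRingEnd ℂ) (modulate (m + 1) k (extendFin n h) t) * modulate (m + 1) k w s *
        (if 0 ≤ t - s ∧ t - s < (m + 1 : ℕ) then 1 else 0) =
      ∑ τ ∈ Finset.range (m + 1), expMode (m + 1) k (-(τ : ℤ)) *
        ((starRingEnd ℂ) (extendFin n h t) * w (t - τ)) := by
    intro t ht
    rw [Finset.mem_Icc] at ht
    simp_rw [mul_ite, mul_one, mul_zero]
    rw [← Finset.sum_filter]
    symm
    refine Finset.sum_bij' (fun (τ : ℕ) _ => t - τ) (fun s _ => (t - s).toNat) ?_ ?_ ?_ ?_ ?_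
    · intro τ hτ
      rw [Finset.mem_range] at hτ
      rw [Finset.mem_filter, Finset.mem_Icc]
      push_cast
      omega
    · intro s hs
      rw [Finset.mem_filter, Finset.mem_Icc] at hs
      rw [Finset.mem_range]
      push_cast at hs
      omega
    · intro τ _
      simp
    · intro s hs
      rw [Finset.mem_filter] at hs
      have := hs.2.1
      omega
    · intro τ _
      rw [modulate_apply, modulate_apply, map_mul, conj_expMode, mul_mul_mul_comm, ← expMode_add]
      congr 2
      ring
  rw [Finset.sum_congr rfl h1, Finset.sum_comm]
  refine Finset.sum_congr rfl fun τ _ => ?_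
  rw [← Finset.mul_sum, inner_restrict, sum_Icc_zero_eq_sum_range,
    ← Fin.sum_univ_eq_sum_range (fun t : ℕ => (starRingEnd ℂ) (extendFin n h t) * w (t - τ))]
  congr 1
  refine Finset.sum_congr rfl fun t _ => ?_
  rw [extendFin_natCast, shift_pow_apply]

/-- Fourier inversion writes the pairing as a combination of frequency terms with coefficients from
the transform of ψ; Hölder's inequality pairs their ℓ¹ norm with the maximum over frequencies. -/
theorem norm_inner_restrict_conv_le_of_averageForm {m n : ℕ} {ρ : ℝ} {ψ : Signal}
    (hψ : IsFeasible m ρ ψ) (h : EuclideanSpace ℂ (Fin (n + 1))) (w : Signal) {b : ℝ} (hb : 0 ≤ b)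
    (hw : ∀ k ∈ Finset.range (m + 1),
      averageForm m n (modulate (m + 1) k (extendFin n h)) (modulate (m + 1) k w) ≤ b) :
    ‖inner ℂ h (restrict n (conv ψ w))‖ ≤ ρ * b := by
  have hm : (0 : ℝ) < (m : ℝ) + 1 := by positivity
  have hs : 0 < √((m : ℝ) + 1) := Real.sqrt_pos.2 hm
  have key : inner ℂ h (restrict n (conv ψ w)) = (((√((m : ℝ) + 1))⁻¹ : ℝ) : ℂ) *
      ∑ k ∈ Finset.range (m + 1), dft m ψ k * ∑ τ ∈ Finset.range (m + 1),
        expMode (m + 1) k (-(τ : ℤ)) * inner ℂ h (restrict n ((shift ^ τ) w)) := by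
    rw [conv_eq_sum hψ.1, map_sum, inner_sum]
    simp_rw [map_smul, inner_smul_right, Finset.mul_sum]
    rw [Finset.sum_comm]
    refine Finset.sum_congr rfl fun τ hτ => ?_
    rw [eq_sum_dft m ψ hτ, Finset.mul_sum, Finset.sum_mul]
    exact Finset.sum_congr rfl fun k _ => by ring
  rw [key, norm_mul, Complex.norm_real, Real.norm_of_nonneg (by positivity)]
  have h1 : ‖∑ k ∈ Finset.range (m + 1), dft m ψ k * ∑ τ ∈ Finset.range (m + 1),
        expMode (m + 1) k (-(τ : ℤ)) * inner ℂ h (restrict n ((shift ^ τ) w))‖ ≤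
      dftNorm1 m ψ * (b * ((m : ℝ) + 1)) := by
    refine (norm_sum_le _ _).trans ?_
    rw [dftNorm1, Finset.sum_mul]
    refine Finset.sum_le_sum fun k hk => ?_
    rw [norm_mul]
    have h2 := hw k hk
    rw [averageForm_modulate, div_le_iff₀ hm] at h2
    gcongr
  calc (√((m : ℝ) + 1))⁻¹ * ‖∑ k ∈ Finset.range (m + 1), dft m ψ k * ∑ τ ∈ Finset.range (m + 1),
        expMode (m + 1) k (-(τ : ℤ)) * inner ℂ h (restrict n ((shift ^ τ) w))‖
      ≤ (√((m : ℝ) + 1))⁻¹ * (ρ / √((m : ℝ) + 1) * (b * ((m : ℝ) + 1))) := by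
        have := hψ.2
        refine mul_le_mul_of_nonneg_left (h1.trans ?_) (by positivity)
        gcongr
    _ = ρ * b := by
        have : √((m : ℝ) + 1) ^ 2 = (m : ℝ) + 1 := Real.sq_sqrt hm.le
        rw [← this, Real.sqrt_sq hs.le]
        field_simp

end Recovery

/-! ### The good event and its probability. -/

section NoiseEvent

/-- The extension by zero of a vector indexed by the window of observation. -/
def extendWindow (m n : ℕ) : EuclideanSpace ℂ (Window m n) →ₗ[ℂ] Signal where
  toFun z := fun t => if ht : t ∈ Set.Icc (-(m : ℤ)) n then z ⟨t, ht⟩ else 0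
  map_add' u v := by ext t; simp only [Pi.add_apply, PiLp.add_apply]; split_ifs <;> simp
  map_smul' c v := by
    ext t
    simp only [Pi.smul_apply, PiLp.smul_apply, RingHom.id_apply]
    split_ifs <;> simp

theorem extendWindow_apply {m n : ℕ} (z : EuclideanSpace ℂ (Window m n)) (t : Window m n) :
    extendWindow m n z t = z t := dif_pos t.2

theorem sum_norm_extendWindow_sq {m n : ℕ} (z : EuclideanSpace ℂ (Window m n)) :
    ∑ t ∈ Finset.Icc (-(m : ℤ)) n, ‖extendWindow m n z t‖ ^ 2 = ‖z‖ ^ 2 := by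
  rw [EuclideanSpace.norm_sq_eq,
    Finset.sum_subtype (p := fun t => t ∈ Set.Icc (-(m : ℤ)) n) (Finset.Icc (-(m : ℤ)) n) (by simp)]
  exact Finset.sum_congr rfl fun t _ => by rw [extendWindow_apply]

/-- The values at `0, …, n` of a vector indexed by the window of observation. -/
def windowRestrict (m n : ℕ) :
    EuclideanSpace ℂ (Window m n) →L[ℂ] EuclideanSpace ℂ (Fin (n + 1)) :=
  LinearMap.toContinuousLinearMap (restrict n ∘ₗ extendWindow m n)

theorem windowRestrict_apply {m n : ℕ} (z : EuclideanSpace ℂ (Window m n)) :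
    windowRestrict m n z = restrict n (extendWindow m n z) := rfl

theorem norm_windowRestrict_le {m n : ℕ} (z : EuclideanSpace ℂ (Window m n)) :
    ‖windowRestrict m n z‖ ≤ ‖z‖ := by
  refine le_of_sq_le_sq ?_ (norm_nonneg _)
  rw [← sum_norm_extendWindow_sq, EuclideanSpace.norm_sq_eq]
  simp only [windowRestrict_apply, restrict_apply]
  rw [Fin.sum_univ_eq_sum_range (fun t : ℕ => ‖extendWindow m n z t‖ ^ 2),
    ← sum_Icc_zero_eq_sum_range n (fun t => ‖extendWindow m n z t‖ ^ 2)]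
  exact Finset.sum_le_sum_of_subset_of_nonneg (Finset.Icc_subset_Icc (by omega) le_rfl)
    fun _ _ _ => by positivity

/-- The noise vectors for which the error of the recovery is controlled. -/
def goodNoise (m n s : ℕ) (α r : ℝ) (U : Submodule ℂ (EuclideanSpace ℂ (Fin (n + 1))))
    (ε : Signal) : Set (EuclideanSpace ℂ (Window m n)) :=
  {z | ‖U.starProjection (windowRestrict m n z)‖ ≤ √(2 * s) + √(2 * Real.log (16 / α)) ∧
    ∑ τ : Fin (m + 1), ‖inner ℂ (Uᗮ.starProjection (windowRestrict m n z))
      (restrict n ((shift ^ (τ : ℕ)) ε))‖ ^ 2 ≤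
        ((m : ℝ) + 1) * (r * √(2 * Real.log (16 / α))) ^ 2 ∧
    ∀ k ∈ Finset.range (m + 1), averageForm m n
      (modulate (m + 1) k (extendFin n (Uᗮ.starProjection (windowRestrict m n z))))
      (modulate (m + 1) k (extendWindow m n z)) ≤
        2 * (1 + 4 * √(((n : ℝ) + 1) / ((m : ℝ) + 1))) ^ 2 *
          Real.log (55 * ((m : ℝ) + (n : ℝ) + 1) / α)}

/-- The linear map whose values enter the left argument of the average form in `goodNoise`. -/
def residualMode (m n k : ℕ) (U : Submodule ℂ (EuclideanSpace ℂ (Fin (n + 1)))) :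
    EuclideanSpace ℂ (Window m n) →ₗ[ℂ] Signal :=
  modulate (m + 1) k ∘ₗ extendFin n ∘ₗ
    (Uᗮ.starProjection ∘L windowRestrict m n : _ →L[ℂ] _).toLinearMap

theorem measurableSet_goodNoise (m n s : ℕ) (α r : ℝ)
    (U : Submodule ℂ (EuclideanSpace ℂ (Fin (n + 1)))) (ε : Signal) :
    MeasurableSet (goodNoise m n s α r U ε) := by
  have h₁ : Measurable fun z : EuclideanSpace ℂ (Window m n) =>
      ‖U.starProjection (windowRestrict m n z)‖ := Continuous.measurable (by fun_prop)
  have h₂ : Measurable fun z : EuclideanSpace ℂ (Window m n) => ∑ τ : Fin (m + 1),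
      ‖inner ℂ (Uᗮ.starProjection (windowRestrict m n z))
        (restrict n ((shift ^ (τ : ℕ)) ε))‖ ^ 2 := Continuous.measurable (by fun_prop)
  refine MeasurableSet.inter (measurableSet_le h₁ measurable_const)
    (MeasurableSet.inter (measurableSet_le h₂ measurable_const) ?_)
  have : {z : EuclideanSpace ℂ (Window m n) | ∀ k ∈ Finset.range (m + 1), averageForm m n
      (modulate (m + 1) k (extendFin n (Uᗮ.starProjection (windowRestrict m n z))))
      (modulate (m + 1) k (extendWindow m n z)) ≤
        2 * (1 + 4 * √(((n : ℝ) + 1) / ((m : ℝ) + 1))) ^ 2 *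
          Real.log (55 * ((m : ℝ) + (n : ℝ) + 1) / α)} =
      ⋂ k ∈ Finset.range (m + 1), {z | averageForm m n (residualMode m n k U z)
        ((modulate (m + 1) k ∘ₗ extendWindow m n) z) ≤
        2 * (1 + 4 * √(((n : ℝ) + 1) / ((m : ℝ) + 1))) ^ 2 *
          Real.log (55 * ((m : ℝ) + (n : ℝ) + 1) / α)} := by
    ext z
    simp only [Set.mem_iInter, Set.mem_ofPred_eq]
    rfl
  change MeasurableSet {z : EuclideanSpace ℂ (Window m n) | _}
  rw [this]
  exact Finset.measurableSet_biInter _ fun k _ =>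
    measurableSet_le (measurable_norm_sum_conj_mul _ _ _ _ _ _) measurable_const

/-- The three failures cost at most α/16, eα/16 and 3α/4, and (1 + e)/16 + 3/4 < 1. -/
theorem gaussianVec_compl_goodNoise_le {m n s : ℕ} (hs : 1 ≤ s) {α r : ℝ} (hα : 0 < α)
    (hα1 : α ≤ 1) (hr : 0 ≤ r) {U : Submodule ℂ (EuclideanSpace ℂ (Fin (n + 1)))}
    (hU : Module.finrank ℂ U ≤ s) {ε : Signal}
    (hε : ∀ τ : ℕ, τ ≤ m → ‖restrict n ((shift ^ τ) ε)‖ ≤ r) :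
    gaussianVec (Window m n) (goodNoise m n s α r U ε)ᶜ ≤ ENNReal.ofReal α := by
  have hm : (0 : ℝ) < (m : ℝ) + 1 := by positivity
  set L := Real.log (16 / α) with hL
  have hexpL : Real.exp L = 16 / α := Real.exp_log (by positivity)
  have he : Real.exp 1 ≤ 2.7182818286 := Real.exp_one_lt_d9.le
  have hL1 : 1 ≤ L := by
    rw [hL, Real.le_log_iff_exp_le (by positivity), le_div_iff₀ hα]
    nlinarith [Real.exp_pos 1]
  have hc2 : √(2 * L) ^ 2 = 2 * L := Real.sq_sqrt (by linarith)
  set E₁ : Set (EuclideanSpace ℂ (Window m n)) :=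
    {z | √(2 * s) + √(2 * L) < ‖U.starProjection (windowRestrict m n z)‖} with hE₁
  set E₂ : Set (EuclideanSpace ℂ (Window m n)) :=
    {z | ((m : ℝ) + 1) * (r * √(2 * L)) ^ 2 < ∑ τ : Fin (m + 1),
      ‖inner ℂ (Uᗮ.starProjection (windowRestrict m n z))
        (restrict n ((shift ^ (τ : ℕ)) ε))‖ ^ 2} with hE₂
  set E₃ : ℕ → Set (EuclideanSpace ℂ (Window m n)) := fun k =>
    {z | 2 * (1 + 4 * √(((n : ℝ) + 1) / ((m : ℝ) + 1))) ^ 2 *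
          Real.log (55 * ((m : ℝ) + (n : ℝ) + 1) / α) <
      averageForm m n (residualMode m n k U z)
        ((modulate (m + 1) k ∘ₗ extendWindow m n) z)} with hE₃
  have hsub : (goodNoise m n s α r U ε)ᶜ ⊆ E₁ ∪ (E₂ ∪ ⋃ k ∈ Finset.range (m + 1), E₃ k) := by
    intro z hz
    by_contra hcon
    simp only [Set.mem_union, Set.mem_iUnion, not_or, not_exists] at hcon
    refine hz ⟨not_lt.1 hcon.1, not_lt.1 hcon.2.1, fun k hk => not_lt.1 (hcon.2.2 k hk)⟩
  have h1 : gaussianVec (Window m n) E₁ ≤ ENNReal.ofReal (α / 16) := by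
    -- Orthonormal coordinates on U, so that the number of coordinates is the dimension of U and not
    -- n + 1.
    let A : EuclideanSpace ℂ (Window m n) →L[ℂ] EuclideanSpace ℂ (Fin (Module.finrank ℂ U)) :=
      ((stdOrthonormalBasis ℂ U).repr.toContinuousLinearEquiv : U →L[ℂ] _) ∘L
        U.orthogonalProjectionOnto ∘L windowRestrict m n
    have hA : ∀ z, ‖A z‖ = ‖U.starProjection (windowRestrict m n z)‖ := by
      intro z
      change ‖(stdOrthonormalBasis ℂ U).repr (U.orthogonalProjectionOnto (windowRestrict m n z))‖ = _
      rw [LinearIsometryEquiv.norm_map]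
      rfl
    have h := gaussianVec_norm_gt_le A (fun z => by
      rw [hA]
      exact (U.norm_starProjection_apply_le _).trans (norm_windowRestrict_le z)) hs
      (by simpa using hU) (Real.sqrt_nonneg (2 * L))
    simp only [hA] at h
    refine h.trans (ENNReal.ofReal_le_ofReal (le_of_eq ?_))
    rw [hc2, mul_div_cancel_left₀ _ two_ne_zero, Real.exp_neg, hexpL, inv_div]
  have h2 : gaussianVec (Window m n) E₂ ≤ ENNReal.ofReal (Real.exp 1 * (α / 16)) := by
    set v : Fin (m + 1) → EuclideanSpace ℂ (Window m n) := fun τ =>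
      (windowRestrict m n).adjoint (Uᗮ.starProjection (restrict n ((shift ^ (τ : ℕ)) ε))) with hv
    have hadj : ∀ h, ‖(windowRestrict m n).adjoint h‖ ≤ ‖h‖ := by
      intro h
      have h1 : ‖windowRestrict m n‖ ≤ 1 :=
        ContinuousLinearMap.opNorm_le_bound _ zero_le_one fun z => by
          simpa using norm_windowRestrict_le z
      calc _ ≤ ‖(windowRestrict m n).adjoint‖ * ‖h‖ := ContinuousLinearMap.le_opNorm _ _
        _ ≤ 1 * ‖h‖ := by
          gcongr
          rwa [LinearIsometryEquiv.norm_map]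
        _ = ‖h‖ := one_mul _
    have h := gaussianVec_sum_norm_inner_sq_gt_le v hr (fun τ => (hadj _).trans
      ((Submodule.norm_starProjection_apply_le _ _).trans
        (hε τ (Nat.lt_succ_iff.1 τ.2)))) hL1
    have hinner : ∀ τ z, ‖inner ℂ (v τ) z‖ = ‖inner ℂ (Uᗮ.starProjection (windowRestrict m n z))
        (restrict n ((shift ^ (τ : ℕ)) ε))‖ := by
      intro τ z
      rw [hv, ContinuousLinearMap.adjoint_inner_left, Submodule.inner_starProjection_left_eq_right,
        norm_inner_symm]
    simp only [hinner, Fintype.card_fin, Nat.cast_add, Nat.cast_one] at h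
    rw [hE₂]
    simp only [mul_pow, hc2, ← mul_assoc] at h ⊢
    refine h.trans (ENNReal.ofReal_le_ofReal (le_of_eq ?_))
    rw [Real.exp_sub, hexpL]
    field_simp
  have h3 : gaussianVec (Window m n) (⋃ k ∈ Finset.range (m + 1), E₃ k) ≤
      ENNReal.ofReal (3 / 4 * α) := by
    calc gaussianVec (Window m n) (⋃ k ∈ Finset.range (m + 1), E₃ k)
        ≤ ∑ k ∈ Finset.range (m + 1), gaussianVec (Window m n) (E₃ k) :=
          measure_biUnion_finset_le _ _
      _ ≤ ∑ k ∈ Finset.range (m + 1), ENNReal.ofReal (3 / 4 * α / ((m : ℝ) + 1)) := by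
          refine Finset.sum_le_sum fun k _ => gaussianVec_averageForm_gt_le m n ?_ ?_ hα hα1
          · intro z
            refine le_trans (le_of_eq ?_) (pow_le_pow_left₀ (norm_nonneg _)
              ((Submodule.norm_starProjection_apply_le Uᗮ _).trans (norm_windowRestrict_le z)) 2)
            rw [sum_Icc_zero_eq_sum_range, EuclideanSpace.norm_sq_eq,
              ← Fin.sum_univ_eq_sum_range (fun t : ℕ => ‖residualMode m n k U z t‖ ^ 2)]
            refine Finset.sum_congr rfl fun t _ => ?_
            rw [← extendFin_natCast]
            exact congrArg (· ^ 2) (norm_modulate_apply _ _ _ _)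
          · intro z
            rw [← sum_norm_extendWindow_sq]
            refine le_of_eq (Finset.sum_congr rfl fun t _ => ?_)
            exact congrArg (· ^ 2) (norm_modulate_apply _ _ _ _)
      _ = ENNReal.ofReal (3 / 4 * α) := by
          rw [Finset.sum_const, Finset.card_range, nsmul_eq_mul, ← ENNReal.ofReal_natCast,
            ← ENNReal.ofReal_mul (by positivity)]
          congr 1
          push_cast
          field_simp
  calc gaussianVec (Window m n) (goodNoise m n s α r U ε)ᶜ
      ≤ ENNReal.ofReal (α / 16) +
          (ENNReal.ofReal (Real.exp 1 * (α / 16)) + ENNReal.ofReal (3 / 4 * α)) :=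
        (measure_mono hsub).trans ((measure_union_le _ _).trans (add_le_add h1
          ((measure_union_le _ _).trans (add_le_add h2 h3))))
    _ ≤ ENNReal.ofReal α := by
        rw [← ENNReal.ofReal_add (by positivity) (by positivity),
          ← ENNReal.ofReal_add (by positivity) (by positivity)]
        refine ENNReal.ofReal_le_ofReal ?_
        nlinarith

end NoiseEvent

/-! ### Assembly and simplification of the constants. -/

section Main

theorem IsConstrainedRecoveryFilter.congr {m n : ℕ} {ρ : ℝ} {y y' φ : Signal}
    (hφ : IsConstrainedRecoveryFilter m n ρ y φ) (h : ∀ t ∈ Set.Icc (-(m : ℤ)) n, y t = y' t) :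
    IsConstrainedRecoveryFilter m n ρ y' φ := by
  have e : ∀ ψ, IsFeasible m ρ ψ → norm2 n (y - conv ψ y) = norm2 n (y' - conv ψ y') := by
    intro ψ hψ
    rw [norm2_eq_norm_restrict, norm2_eq_norm_restrict, map_sub, map_sub,
      restrict_conv_congr hψ.1 h]
    congr 2
    ext t
    rw [restrict_apply, restrict_apply]
    refine h _ ⟨by omega, ?_⟩
    have := t.2
    omega
  refine ⟨hφ.1, fun ψ hψ => ?_⟩
  rw [← e φ hφ.1, ← e ψ hψ]
  exact hφ.2 ψ hψ

/-- The event depends neither on the filters nor on ρ. On it the bound is deterministic and holds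
for every minimizer, so no measurable selection of the minimizer is needed. -/
theorem exists_noise_event {Ω : Type*} [MeasurableSpace Ω] (P : Measure Ω) [IsProbabilityMeasure P]
    (m n s : ℕ) (σ κ ρ α : ℝ) (x φo : Signal) (ζ : ℤ → Ω → ℂ) (hσ : 0 ≤ σ) (hρ : 1 ≤ ρ)
    (hα : 0 < α) (hα1 : α ≤ 1) (hζ : IsGaussianNoise P m n ζ) (hφo : IsFeasible m ρ φo)
    (hx : NearShiftInvariant m n s (σ * κ) x) :
    ∃ Ξ : Set (Window m n → ℂ), MeasurableSet Ξ ∧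
      1 - α ≤ P.real {ω | (fun τ : Window m n => ζ τ ω) ∈ Ξ} ∧
      ∀ ω : Ω, (fun τ : Window m n => ζ τ ω) ∈ Ξ → ∀ φ : Signal,
        IsConstrainedRecoveryFilter m n ρ (obs x σ ζ ω) φ →
        norm2 n (x - conv φ (obs x σ ζ ω)) ≤ norm2 n (x - conv φo (obs x σ ζ ω)) +
          2 * σ * (√(ρ * (2 * (1 + 4 * √(((n : ℝ) + 1) / ((m : ℝ) + 1))) ^ 2 *
                  Real.log (55 * ((m : ℝ) + (n : ℝ) + 1) / α)) +
                (ρ + 1) * √(2 * Real.log (16 / α)) * κ) +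
            √(2 * (s : ℝ)) + √(2 * Real.log (16 / α))) := by
  obtain ⟨hs, -, S, hS, hdim, u, hu, ε, rfl, hε⟩ := hx
  have hr : 0 ≤ σ * κ := (Real.sqrt_nonneg _).trans (hε 0 (Nat.zero_le m))
  -- `Module.finrank` is zero in infinite dimension, so s ≥ 1 forces finite dimension.
  have : Module.Finite ℂ S := Module.finite_of_finrank_pos (by omega)
  set U := S.map (restrict n) with hU
  have hUdim : Module.finrank ℂ U ≤ s := hdim ▸ Submodule.finrank_map_le _ S
  have hshift : ∀ τ : ℕ, (shift ^ τ) u ∈ S := by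
    intro τ
    induction τ with
    | zero => simpa using hu
    | succ k ih =>
      rw [pow_succ', Module.End.mul_apply, ← hS]
      exact Submodule.mem_map_of_mem ih
  set V : ℝ := 2 * (1 + 4 * √(((n : ℝ) + 1) / ((m : ℝ) + 1))) ^ 2 *
    Real.log (55 * ((m : ℝ) + (n : ℝ) + 1) / α) with hV
  set c : ℝ := √(2 * Real.log (16 / α)) with hc
  have hV0 : 0 ≤ V := by
    have : 0 ≤ Real.log (55 * ((m : ℝ) + (n : ℝ) + 1) / α) := by
      refine Real.log_nonneg ((one_le_div hα).2 ?_)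
      have : (0 : ℝ) ≤ (m : ℝ) + n := by positivity
      linarith
    positivity
  set G := goodNoise m n s α (σ * κ) U ε with hG
  have hGm : MeasurableSet G := measurableSet_goodNoise m n s α (σ * κ) U ε
  have hlp : Measurable (WithLp.toLp 2 : (Window m n → ℂ) → EuclideanSpace ℂ (Window m n)) := by
    fun_prop
  have hζm : Measurable fun ω (τ : Window m n) => ζ τ ω := measurable_pi_lambda _ hζ.measurable
  refine ⟨WithLp.toLp 2 ⁻¹' G, hlp hGm, ?_, ?_⟩
  · have hlaw : P.map (fun ω (τ : Window m n) => ζ τ ω) =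
        Measure.pi fun _ : Window m n => stdComplexGaussian := by
      rw [(iIndepFun_iff_map_fun_eq_pi_map fun τ => (hζ.measurable τ).aemeasurable).1 hζ.indep]
      congr 1
      exact funext fun τ => hζ.law τ
    have e : P {ω | (fun τ : Window m n => ζ τ ω) ∈ WithLp.toLp 2 ⁻¹' G} =
        gaussianVec (Window m n) G := by
      rw [gaussianVec, Measure.map_apply hlp hGm, ← hlaw, Measure.map_apply hζm (hlp hGm)]
      rfl
    have hcompl := gaussianVec_compl_goodNoise_le hs hα hα1 hr hUdim (ε := ε) (fun τ hτ => by
      rw [← norm2_eq_norm_restrict]; exact hε τ hτ)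
    rw [measureReal_def, e, ← measureReal_def]
    have h2 := probReal_compl_eq_one_sub (μ := gaussianVec (Window m n)) hGm
    have h3 : (gaussianVec (Window m n)).real Gᶜ ≤ α := ENNReal.toReal_le_of_le_ofReal hα.le hcompl
    linarith
  · intro ω hω φ hφ
    set z : EuclideanSpace ℂ (Window m n) := WithLp.toLp 2 fun τ : Window m n => ζ τ ω with hz
    obtain ⟨g1, g2, g3⟩ : z ∈ G := hω
    set w := extendWindow m n z with hw
    have hobs : ∀ t ∈ Set.Icc (-(m : ℤ)) n,
        obs (u + ε) σ ζ ω t = (u + ε + (σ : ℂ) • w) t := by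
      intro t ht
      have : w t = ζ t ω := extendWindow_apply z ⟨t, ht⟩
      rw [Pi.add_apply, Pi.smul_apply, this]
      rfl
    have hrec : ∀ ψ, IsFeasible m ρ ψ → norm2 n (u + ε - conv ψ (obs (u + ε) σ ζ ω)) =
        norm2 n (u + ε - conv ψ (u + ε + (σ : ℂ) • w)) := by
      intro ψ hψ
      rw [norm2_eq_norm_restrict, norm2_eq_norm_restrict, map_sub, map_sub,
        restrict_conv_congr hψ.1 hobs]
    rw [hrec φ hφ.1, hrec φo hφo]
    have key := norm2_recovery_le hσ U (fun τ => Submodule.mem_map_of_mem (hshift τ))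
      (hφ.congr hobs) hφo (T := √(2 * s) + c) (b₁ := ρ * (σ * κ * c)) (b₂ := ρ * V) g1
      (fun ψ hψ => norm_inner_restrict_conv_le hψ _ ε (by positivity) (by linarith) g2)
      (fun ψ hψ => norm_inner_restrict_conv_le_of_averageForm hψ _ w hV0 g3)
    have hsqrt : √(4 * σ * (ρ * (σ * κ * c) + σ * (ρ * V))) ≤
        2 * σ * √(ρ * V + (ρ + 1) * c * κ) := by
      -- The sign of κ is known only for σ > 0; for σ = 0 both sides vanish.
      rcases hσ.eq_or_lt with rfl | hσ0
      · simp
      · have hκ : 0 ≤ κ := nonneg_of_mul_nonneg_right hr hσ0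
        have h4 : 2 * σ * √(ρ * V + (ρ + 1) * c * κ) =
            √((2 * σ) ^ 2 * (ρ * V + (ρ + 1) * c * κ)) := by
          rw [Real.sqrt_mul (by positivity), Real.sqrt_sq (by positivity)]
        rw [h4]
        refine Real.sqrt_le_sqrt ?_
        have : 0 ≤ σ ^ 2 * (c * κ) := by positivity
        nlinarith
    linarith

/-- The explicit error term for filters and samples of the same length is dominated by the
simplified one, for confidence levels bounded away from zero. -/
theorem explicit_error_le {α₀ α κ ρ : ℝ} {n s : ℕ} (hn : 1 ≤ n) (hα₀ : α₀ < 1) (hα : 0 < α)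
    (hαα₀ : α ≤ α₀) (hκ : 0 ≤ κ) (hρ : 1 ≤ ρ) :
    2 * (√(ρ * (2 * (1 + 4 * √(((n : ℝ) + 1) / ((n : ℝ) + 1))) ^ 2 *
          Real.log (55 * ((n : ℝ) + (n : ℝ) + 1) / α)) +
        (ρ + 1) * √(2 * Real.log (16 / α)) * κ) +
      √(2 * (s : ℝ)) + √(2 * Real.log (16 / α))) ≤
    6 * √(50 * (1 + Real.log 165 / Real.log (1 / α₀))) *
      √((s : ℝ) + ρ * (κ * √(Real.log (1 / α)) + Real.log ((n : ℝ) / α))) := by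
  have hα₀0 : 0 < α₀ := hα.trans_le hαα₀
  have hn1 : (1 : ℝ) ≤ n := by exact_mod_cast hn
  set D : ℝ := 1 + Real.log 165 / Real.log (1 / α₀) with hD
  set a : ℝ := Real.log (1 / α₀) with ha
  set l : ℝ := Real.log (1 / α) with hl
  set Λ : ℝ := Real.log ((n : ℝ) / α) with hΛ
  have ha0 : 0 < a := Real.log_pos (by rw [one_lt_div hα₀0]; exact hα₀)
  have hal : a ≤ l := Real.log_le_log (by positivity) (one_div_le_one_div_of_le hα hαα₀)
  have hlΛ : l ≤ Λ := Real.log_le_log (by positivity) (by gcongr)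
  have h165 : 0 ≤ Real.log 165 := Real.log_nonneg (by norm_num)
  have hD1 : 1 ≤ D := by
    rw [hD]
    have : 0 ≤ Real.log 165 / a := by positivity
    linarith
  -- Since t ≥ a = ln(1/α₀) > 0, the constant ln 165 is absorbed into a multiple of t. Here 165 = 3
  -- · 55, because 2n + 1 ≤ 3n.
  have hlin : ∀ t, a ≤ t → Real.log 165 + t ≤ D * t := by
    intro t ht
    have : Real.log 165 / a * a ≤ Real.log 165 / a * t := by gcongr
    rw [div_mul_cancel₀ _ ha0.ne'] at this
    rw [hD]
    linarith
  have h16 : Real.log (16 / α) ≤ D * l := by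
    refine le_trans ?_ (hlin l hal)
    rw [div_eq_mul_one_div, Real.log_mul (by norm_num) (by positivity)]
    gcongr
    norm_num
  have h55 : Real.log (55 * ((n : ℝ) + (n : ℝ) + 1) / α) ≤ D * Λ := by
    refine le_trans ?_ (hlin Λ (hal.trans hlΛ))
    rw [hΛ, ← Real.log_mul (by norm_num) (by positivity)]
    refine Real.log_le_log (by positivity) ?_
    rw [← mul_div_assoc]
    refine div_le_div_of_nonneg_right ?_ hα.le
    linarith
  have hq : √(((n : ℝ) + 1) / ((n : ℝ) + 1)) = 1 := by
    rw [div_self (by positivity), Real.sqrt_one]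
  have hl0 : 0 < l := ha0.trans_le hal
  have hΛ0 : 0 < Λ := hl0.trans_le hlΛ
  set G : ℝ := (s : ℝ) + ρ * (κ * √l + Λ) with hG
  have hs0 : (0 : ℝ) ≤ s := by positivity
  have hG0 : 0 ≤ G := by positivity
  rw [hq]
  have hc : √(2 * Real.log (16 / α)) ≤ 2 * D * √l := by
    calc √(2 * Real.log (16 / α)) ≤ √((2 * D) ^ 2 * l) := by
          refine Real.sqrt_le_sqrt ?_
          have : D * l ≤ D * l * D := le_mul_of_one_le_right (by positivity) hD1
          nlinarith
      _ = 2 * D * √l := by rw [Real.sqrt_mul (by positivity), Real.sqrt_sq (by positivity)]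
  -- Each of the three terms is at most √(50 D G), with 50 = 2(1 + 4)²; the outer factor 2 then
  -- gives 6.
  have e1 : √(ρ * (2 * (1 + 4 * 1) ^ 2 * Real.log (55 * ((n : ℝ) + (n : ℝ) + 1) / α)) +
      (ρ + 1) * √(2 * Real.log (16 / α)) * κ) ≤ √(50 * D * G) := by
    refine Real.sqrt_le_sqrt ?_
    have i1 : ρ * (2 * (1 + 4 * 1) ^ 2 * Real.log (55 * ((n : ℝ) + (n : ℝ) + 1) / α)) ≤
        ρ * (50 * (D * Λ)) := by
      norm_num
      gcongr
    have i2 : (ρ + 1) * √(2 * Real.log (16 / α)) * κ ≤ (2 * ρ) * (2 * D * √l) * κ := by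
      gcongr
      linarith
    have i3 : 0 ≤ D * s := by positivity
    have i4 : 0 ≤ ρ * D * √l * κ := by positivity
    have i5 : 50 * D * G = 50 * (D * s) + 50 * (ρ * D * √l * κ) + ρ * (50 * (D * Λ)) := by
      rw [hG]; ring
    rw [i5]
    linarith
  have e2 : √(2 * (s : ℝ)) ≤ √(50 * D * G) := by
    refine Real.sqrt_le_sqrt ?_
    have i1 : (s : ℝ) ≤ G := by
      rw [hG]
      have : 0 ≤ ρ * (κ * √l + Λ) := by positivity
      linarith
    nlinarith
  have e3 : √(2 * Real.log (16 / α)) ≤ √(50 * D * G) := by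
    refine Real.sqrt_le_sqrt ?_
    have i1 : Λ ≤ G := by
      rw [hG]
      have : 0 ≤ ρ * (κ * √l) := by positivity
      nlinarith
    have i2 : D * l ≤ D * G := by
      gcongr
      exact hlΛ.trans i1
    have i3 : 0 ≤ D * G := by positivity
    linarith
  rw [mul_assoc 6, ← Real.sqrt_mul (by positivity)]
  linarith

end Main

end

end FilterRecovery

theorem mainTheorem1 :
    -- first part: filters and sample of the same length
    (∀ α₀ : ℝ, α₀ < 1 → ∃ C : ℝ, 0 < C ∧
      ∀ (Ω : Type*) [MeasurableSpace Ω] (P : Measure Ω) [IsProbabilityMeasure P]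
        (n s : ℕ) (σ κ ρ α : ℝ) (x φo : FilterRecovery.Signal) (ζ : ℤ → Ω → ℂ),
        1 ≤ n → 0 ≤ σ → 1 ≤ ρ → 0 < α → α ≤ α₀ →
        FilterRecovery.IsGaussianNoise P n n ζ →
        FilterRecovery.IsFilter n φo →
        FilterRecovery.dftNorm1 n φo ≤ ρ / √((n : ℝ) + 1) →
        FilterRecovery.NearShiftInvariant n n s (σ * κ) x →
        ∃ E : Set Ω, MeasurableSet E ∧ 1 - α ≤ P.real E ∧
          ∀ ω ∈ E, ∀ φ : FilterRecovery.Signal,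
            FilterRecovery.IsConstrainedRecoveryFilter n n ρ (FilterRecovery.obs x σ ζ ω) φ →
            FilterRecovery.norm2 n (x - FilterRecovery.conv φ (FilterRecovery.obs x σ ζ ω)) ≤
              FilterRecovery.norm2 n (x - FilterRecovery.conv φo (FilterRecovery.obs x σ ζ ω)) +
                C * σ * √((s : ℝ) + ρ * (κ * √(Real.log (1 / α)) + Real.log ((n : ℝ) / α)))) ∧
    -- second part: explicit constants, filters of order m and a sample of length n
    (∀ (Ω : Type*) [MeasurableSpace Ω] (P : Measure Ω) [IsProbabilityMeasure P]
        (m n s : ℕ) (σ κ ρ α : ℝ) (x φo : FilterRecovery.Signal) (ζ : ℤ → Ω → ℂ),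
        0 ≤ σ → 1 ≤ ρ → 0 < α → α ≤ 1 →
        FilterRecovery.IsGaussianNoise P m n ζ →
        FilterRecovery.IsFilter m φo →
        FilterRecovery.dftNorm1 m φo ≤ ρ / √((m : ℝ) + 1) →
        FilterRecovery.NearShiftInvariant m n s (σ * κ) x →
        ∃ Ξ : Set (FilterRecovery.Window m n → ℂ), MeasurableSet Ξ ∧
          1 - α ≤ P.real {ω | (fun τ : FilterRecovery.Window m n => ζ τ ω) ∈ Ξ} ∧
          ∀ ω : Ω, (fun τ : FilterRecovery.Window m n => ζ τ ω) ∈ Ξ →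
            ∀ φ : FilterRecovery.Signal,
            FilterRecovery.IsConstrainedRecoveryFilter m n ρ (FilterRecovery.obs x σ ζ ω) φ →
            FilterRecovery.norm2 n (x - FilterRecovery.conv φ (FilterRecovery.obs x σ ζ ω)) ≤
              FilterRecovery.norm2 n (x - FilterRecovery.conv φo (FilterRecovery.obs x σ ζ ω)) +
                2 * σ *
                  (√(ρ * (2 * (1 + 4 * √(((n : ℝ) + 1) / ((m : ℝ) + 1))) ^ 2 *
                          Real.log (55 * ((m : ℝ) + (n : ℝ) + 1) / α)) +
                        (ρ + 1) * √(2 * Real.log (16 / α)) * κ) +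
                    √(2 * (s : ℝ)) + √(2 * Real.log (16 / α)))) := by
  constructor
  · intro α₀ hα₀
    -- For α₀ < 0 the square root may be zero, as `Real.log` ignores signs and `√` truncates at
    -- zero. The maximum keeps the constant positive; no α is admissible in that case.
    refine ⟨max 1 (6 * √(50 * (1 + Real.log 165 / Real.log (1 / α₀)))),
      lt_max_of_lt_left one_pos, ?_⟩
    intro Ω _ P _ n s σ κ ρ α x φo ζ hn hσ hρ hα hαα₀ hζ hφo hφo' hx
    obtain ⟨Ξ, hΞ, hP, h⟩ := FilterRecovery.exists_noise_event P n n s σ κ ρ α x φo ζ hσ hρ hα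
      (hαα₀.trans hα₀.le) hζ ⟨hφo, hφo'⟩ hx
    refine ⟨{ω | (fun τ : FilterRecovery.Window n n => ζ τ ω) ∈ Ξ},
      measurable_pi_lambda _ hζ.measurable hΞ, hP, fun ω hω φ hφ => ?_⟩
    refine (h ω hω φ hφ).trans (add_le_add le_rfl ?_)
    rcases hσ.eq_or_lt with rfl | hσ0
    · simp
    · have hκ : 0 ≤ κ := by
        obtain ⟨-, -, S, -, -, u, -, ε, -, hε⟩ := hx
        exact nonneg_of_mul_nonneg_right
          ((Real.sqrt_nonneg _).trans (hε 0 (Nat.zero_le n))) hσ0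
      have key := FilterRecovery.explicit_error_le (s := s) hn hα₀ hα hαα₀ hκ hρ
      have key' := key.trans (mul_le_mul_of_nonneg_right (le_max_right 1 _) (Real.sqrt_nonneg _))
      have := mul_le_mul_of_nonneg_left key' hσ
      linarith
  · intro Ω _ P _ m n s σ κ ρ α x φo ζ hσ hρ hα hα1 hζ hφo hφo' hx
    exact FilterRecovery.exists_noise_event P m n s σ κ ρ α x φo ζ hσ hρ hα hα1 hζ ⟨hφo, hφo'⟩ hx
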